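/- **Setting.** Let $0\le p\le n$. Super forms on $\mathbb R^n$ are the expressions $\sum_{K,L}\alpha_{KL}(x)\,dx_K\wedge d\xi_L$ in the anticommuting symbols $dx_1,\dots,dx_n,d\xi_1,\dots,d\xi_n$, with coefficients depending only on $x\in\mathbb R^n$; such a form has bidegree $(q,q)$ if $|K|=|L|=q$ throughout. A form $g\,dx_1\wedge d\xi_1\wedge\dots\wedge dx_n\wedge d\xi_n$ has integral $\int_{\mathbb R^n}g\,dx$. A current of bidegree $(p,p)$ is a continuous linear functional on the space of smooth compactly supported forms of bidegree $(n-p,n-p)$; its support is the complement of the largest open set on which it vanishes. For smooth $f$ put $dd^{\#}f=\sum_{i,j}\frac{\partial^2 f}{\partial x_i\partial x_j}\,dx_i\wedge d\xi_j$. For convex functions $f_1,\dots,f_p$ on $\mathbb R^n$, the current $dd^{\#}f_1\wedge\dots\wedge dd^{\#}f_p$ is the weak limit of $dd^{\#}f_1^k\wedge\dots\wedge dd^{\#}f_p^k$ as $k\to\infty$, for any sequences of smooth convex functions $f_i^k$ converging to $f_i$ uniformly on compact sets. A tropical polynomial is a function $f(x)=\max_{a\in A}(-\nu(a)+a\cdot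 x)$ with $A\subset\mathbb Z^n$ finite and nonempty and $\nu:A\to\mathbb R$; $V_f$ denotes its tropical hypersurface, and $V_{f_1}\wedge\dots\wedge V_{f_p}:=dd^{\#}f_1\wedge\dots\wedge dd^{\#}f_p$. A set $S\subset\mathbb R^n$ *has dimension $d$* if it is a piecewise smooth manifold of dimension $d$: $S$ is a disjoint union of finitely many nonempty embedded smooth submanifolds of $\mathbb R^n$, each of dimension at most $d$, at least one being of dimension $d$, and $S$ is the closure of the union of those of dimension $d$. It is *piecewise affine of dimension $d$* if these pieces can be chosen to be relatively open convex polyhedra, i.e. nonempty intersections of an affine subspace with finitely many open half-spaces. **Statement.** Let $f_1,\dots,f_p$ be tropical polynomials on $\mathbb R^n$. Then the intersection current $V_{f_1}\wedge\dots\wedge V_{f_p}$ is well defined (there is exactly one current of bidegree $(p,p)$ which is the weak limit for all approximating sequences as above). If $V_{f_1}\wedge\dots\wedge V_{f_p}\neq 0$, then $$\dim\operatorname{Supp}(V_{f_1}\wedge\dots\wedge V_{f_p})=n-p ,$$ and $\operatorname{Supp}(V_{f_1}\wedge\dots\wedge V_{f_p})$ is piecewise affine (of dimension $n-p$). -/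

import Mathlib

open Set Filter Topology MeasureTheory
open scoped ContDiff Distributions

noncomputable section

namespace SuperCurrents

/-- The space `𝕍 = ℝⁿ` with its standard inner product. -/
abbrev V (n : ℕ) : Type := EuclideanSpace ℝ (Fin n)

/-! ### Super forms -/

/-- The algebra of constant super forms: the exterior algebra on the `2n` symbols
`dx_1, dξ_1, …, dx_n, dξ_n` (the index `(i, 0)` stands for `dx_i`, and `(i, 1)` for `dξ_i`). -/
abbrev FormAlg (n : ℕ) : Type := ExteriorAlgebra ℝ (Fin n × Fin 2 → ℝ)

/-- The form `dx_i`. -/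
def dx {n : ℕ} (i : Fin n) : FormAlg n :=
  ExteriorAlgebra.ι ℝ (Pi.single (i, 0) 1)

/-- The form `dξ_i`. -/
def dxi {n : ℕ} (i : Fin n) : FormAlg n :=
  ExteriorAlgebra.ι ℝ (Pi.single (i, 1) 1)

/-- `dx_K = dx_{k_1} ∧ … ∧ dx_{k_q}` for `K = {k_1 < … < k_q}`. -/
def dxMulti {n : ℕ} (K : Finset (Fin n)) : FormAlg n :=
  (K.sort.map dx).prod

/-- `dξ_L = dξ_{l_1} ∧ … ∧ dξ_{l_q}` for `L = {l_1 < … < l_q}`. -/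
def dxiMulti {n : ℕ} (L : Finset (Fin n)) : FormAlg n :=
  (L.sort.map dxi).prod

/-- The coefficient `c` of the component `c · dx_1 ∧ dξ_1 ∧ … ∧ dx_n ∧ dξ_n` of degree `2n`:
the linear form on the exterior algebra which is the determinant in degree `2n` (with respect to
the ordered basis `dx_1, dξ_1, …, dx_n, dξ_n`) and vanishes in all the other degrees. -/
def topCoeff (n : ℕ) : FormAlg n →ₗ[ℝ] ℝ :=
  ExteriorAlgebra.liftAlternating
    (Function.update (fun _ => 0) (n * 2)
      ((Pi.basisFun ℝ (Fin n × Fin 2)).reindex finProdFinEquiv).det)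

/-- Partial derivative `∂f/∂x_i`. -/
def pderiv {n : ℕ} (i : Fin n) (f : V n → ℝ) (x : V n) : ℝ :=
  fderiv ℝ f x (EuclideanSpace.single i 1)

/-- For a smooth function `f`, the value at `x` of the form
`dd^# f = d (∑_j ∂_j f dξ_j) = ∑_{i,j} ∂_i ∂_j f dx_i ∧ dξ_j`. -/
def ddSharp {n : ℕ} (f : V n → ℝ) (x : V n) : FormAlg n :=
  ∑ i, ∑ j, pderiv i (pderiv j f) x • (dx i * dxi j)

/-- For smooth functions `f_1, …, f_p`, the value at `x` of `dd^# f_1 ∧ … ∧ dd^# f_p`. -/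
def ddSharpProd {n p : ℕ} (f : Fin p → V n → ℝ) (x : V n) : FormAlg n :=
  (List.ofFn fun i => ddSharp (f i) x).prod

/-- Multi-indices of length `q`, i.e. strictly increasing `q`-tuples in `{1, …, n}`. -/
abbrev MultiIndex (n q : ℕ) : Type := {K : Finset (Fin n) // K.card = q}

/-- The space `𝓓^{q,q}` of smooth compactly supported super forms
`∑_{K,L} α_{KL}(x) dx_K ∧ dξ_L` of bidegree `(q,q)`, with its usual LF topology. A form is given
by its matrix of coefficients. -/
abbrev TestForm (n q : ℕ) : Type :=
  𝓓((⊤ : TopologicalSpace.Opens (V n)), MultiIndex n q → MultiIndex n q → ℝ)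

/-- The value at `x` of the form `∑_{K,L} α_{KL}(x) dx_K ∧ dξ_L`. -/
def TestForm.value {n q : ℕ} (α : TestForm n q) (x : V n) : FormAlg n :=
  ∑ K : MultiIndex n q, ∑ L : MultiIndex n q, α x K L • (dxMulti K.1 * dxiMulti L.1)

/-! ### Currents -/

/-- Currents of bidegree `(p,p)` on `ℝⁿ` (for `p ≤ n`): the topological dual of the space of
compactly supported smooth forms of bidegree `(n-p,n-p)`. Its support is `dsupport`: the
complement of the largest open set on which the current vanishes. -/
abbrev Current (n p : ℕ) : Type := TestForm n (n - p) →L[ℝ] ℝ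

/-- For smooth `f_1, …, f_p`, the pairing
`⟨dd^# f_1 ∧ … ∧ dd^# f_p, α⟩ = ∫ dd^# f_1 ∧ … ∧ dd^# f_p ∧ α`, where
`∫ g · dx_1 ∧ dξ_1 ∧ … ∧ dx_n ∧ dξ_n` is the Lebesgue integral of `g`. -/
def smoothPairing {n p : ℕ} (f : Fin p → V n → ℝ) (α : TestForm n (n - p)) : ℝ :=
  ∫ x, topCoeff n (ddSharpProd f x * TestForm.value α x)

/-- `T` is the intersection product `dd^# f_1 ∧ … ∧ dd^# f_p` of the convex functions
`f_1, …, f_p`: for all sequences of smooth convex functions `g_i^k → f_i`, converging uniformly on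
compact sets, `dd^# g_1^k ∧ … ∧ dd^# g_p^k → T` weakly. -/
def IsIntersectionCurrent {n p : ℕ} (f : Fin p → V n → ℝ) (T : Current n p) : Prop :=
  ∀ g : ℕ → Fin p → V n → ℝ,
    (∀ k i, ContDiff ℝ ∞ (g k i)) →
    (∀ k i, ConvexOn ℝ univ (g k i)) →
    (∀ i, TendstoLocallyUniformly (fun k => g k i) (f i) atTop) →
    ∀ α : TestForm n (n - p), Tendsto (fun k => smoothPairing (g k) α) atTop (𝓝 (T α))

/-! ### Tropical polynomials -/

/-- Tropical polynomials `f(x) = max_{a ∈ A} (-ν(a) + a · x)`, with `A ⊆ ℤⁿ` finite and nonempty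
and `ν : A → ℝ` arbitrary. -/
def IsTropicalPolynomial {n : ℕ} (f : V n → ℝ) : Prop :=
  ∃ (A : Finset (Fin n → ℤ)) (hA : A.Nonempty) (ν : (Fin n → ℤ) → ℝ),
    ∀ x, f x = A.sup' hA fun a => -ν a + ∑ i, (a i : ℝ) * x i

/-! ### Piecewise smooth and piecewise affine sets -/

/-- Nonempty (embedded) smooth submanifolds of `ℝⁿ` of dimension `d`. -/
def IsSmoothPiece {n : ℕ} (A : Set (V n)) (d : ℕ) : Prop :=
  A.Nonempty ∧ ∀ x ∈ A, ∃ Φ : OpenPartialHomeomorph (V n) (V n),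
    x ∈ Φ.source ∧ ContDiffOn ℝ ∞ Φ Φ.source ∧ ContDiffOn ℝ ∞ Φ.symm Φ.target ∧
      ∃ F : Submodule ℝ (V n), Module.finrank ℝ F = d ∧ ∀ y ∈ Φ.source, (y ∈ A ↔ Φ y ∈ F)

/-- Nonempty relatively open convex polyhedra of dimension `d`: the intersection of an affine
subspace of dimension `d` with finitely many open half-spaces. -/
def IsAffinePiece {n : ℕ} (A : Set (V n)) (d : ℕ) : Prop :=
  A.Nonempty ∧ ∃ L : AffineSubspace ℝ (V n), Module.finrank ℝ L.direction = d ∧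
    ∃ H : Set ((V n →L[ℝ] ℝ) × ℝ), H.Finite ∧ A = {x | x ∈ L ∧ ∀ h ∈ H, h.2 < h.1 x}

/-- `S` consists of finitely many (and at least one) pieces of dimension `d`, glued together along
finitely many pieces of lower dimension: `S` is the disjoint union of these pieces, and it is the
closure of the union of the pieces of dimension `d`. -/
def IsGluedFrom {n : ℕ} (Piece : Set (V n) → ℕ → Prop) (S : Set (V n)) (d : ℕ) : Prop :=
  ∃ M N : Set (Set (V n)), M.Finite ∧ N.Finite ∧ M.Nonempty ∧
    (∀ A ∈ M, Piece A d) ∧ (∀ B ∈ N, ∃ e < d, Piece B e) ∧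
    (M ∪ N).PairwiseDisjoint id ∧ S = ⋃₀ M ∪ ⋃₀ N ∧ S = closure (⋃₀ M)

/-- `S` has dimension `d`, in the sense that it is a piecewise smooth manifold of dimension `d`. -/
def HasDimension {n : ℕ} (S : Set (V n)) (d : ℕ) : Prop :=
  IsGluedFrom IsSmoothPiece S d

/-- `S` is piecewise affine of dimension `d`. -/
def IsPiecewiseAffine {n : ℕ} (S : Set (V n)) (d : ℕ) : Prop :=
  IsGluedFrom IsAffinePiece S d

end SuperCurrents

end

/-!
The forms `dd^# f` are `(1,1)`-forms whose matrix of coefficients is the Hessian of `f`, and so the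
coefficient of a product of such forms is a mixed discriminant of matrices (`topCoeff_prod_formOf`,
`exists_smoothPairing_eq`). All analysis rests on two properties of mixed discriminants. They are
monotone on positive semidefinite matrices, and a slot filled with an arbitrary matrix of size at
most one is dominated by the same slot filled with the identity (`abs_mixedDisc_piecewise_le`,
a consequence of the Cauchy–Binet formula). Moreover a factor `dd^# u` can be integrated by parts
onto the test function (`integral_mul_mixedDisc_hess`), because Hessians are closed fields.

Existence and uniqueness of the intersection current. Integrating the factors by parts one at a time
gives the Chern–Levine–Nirenberg inequality (`integral_cutoff_mul_mixedDisc_le`): the mass of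
`dd^# g_1 ∧ … ∧ dd^# g_p` on a ball is bounded by the suprema of the convex functions `g_i` on a
larger ball. Applied to the differences of two approximating sequences, the same argument shows
that the limit exists, does not depend on the sequence, and near a point depends only on the
functions near that point (`tendsto_smoothPairing_sub`). A tropical polynomial is approximated by
the smooth convex functions `(k+1)⁻¹ log ∑ exp((k+1)(-ν(a) + a · x))`.

The support. The cell of `x` consists of the points where the same monomials attain the maxima as at
`x`. There are finitely many cells, and each is relatively open in a translate of the space of
directions in which the active monomials of each polynomial vary together. Near `x` the polynomials
may be replaced by the maxima of the monomials active at `x`, whose smoothings are, up to additive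
constants, invariant under translations along the cell. It follows that:
* A cell of dimension larger than `n - p` does not meet the support, since the Hessians have a
  common kernel that is too large for a mixed discriminant not to vanish
  (`notMem_dsupport_of_finrank_gt`).
* A cell which meets the support is contained in it (`mem_dsupport_of_active_eq`).
* A cell of dimension less than `n - p` is not charged. After subtraction of an affine function the
  polynomials are `O(1/t)` on the tube of radius `1/t` around the cell, and the Hessian of a cutoff
  function for the tube is `O(t^2)`, so that the Chern–Levine–Nirenberg inequality bounds the mass
  of the tube by `t^p` times its volume, i.e. by `O(1/t)` (`exists_abs_apply_smulFun_le`). As the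
  cells near a point of the cell which differ from it have larger dimension, an induction on the
  codimension shows that the support is the closure of its part in the cells of dimension `n - p`
  (`mem_closure_of_mem_dsupport`).

Hence the support is the union of finitely many cells of dimension at most `n - p`, and the closure
of those of dimension `n - p`. The cells are relatively open polyhedra, which are in particular
smooth submanifolds.
-/

open Set Filter Topology MeasureTheory
open scoped ContDiff Distributions

namespace SuperCurrents

/-! ### Mixed discriminants -/

/-- The (unnormalised) mixed discriminant of `n` matrices of size `n × n`: the polarisation of
`n! · det`, as a multilinear form. -/
noncomputable def mixedDisc (n : ℕ) :
    MultilinearMap ℝ (fun _ : Fin n => Matrix (Fin n) (Fin n) ℝ) ℝ :=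
  ∑ σ : Equiv.Perm (Fin n), ∑ τ : Equiv.Perm (Fin n),
    ((Equiv.Perm.sign σ : ℤ) * (Equiv.Perm.sign τ : ℤ) : ℝ) •
      (MultilinearMap.mkPiAlgebra ℝ (Fin n) ℝ).compLinearMap
        fun l => Matrix.entryLinearMap ℝ ℝ (σ l) (τ l)

variable {n : ℕ}

theorem mixedDisc_apply (A : Fin n → Matrix (Fin n) (Fin n) ℝ) :
    mixedDisc n A = ∑ σ : Equiv.Perm (Fin n), ∑ τ : Equiv.Perm (Fin n),
      ((Equiv.Perm.sign σ : ℤ) * (Equiv.Perm.sign τ : ℤ) : ℝ) * ∏ l, A l (σ l) (τ l) := by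
  simp [mixedDisc]

theorem mixedDisc_eq_sum_det (A : Fin n → Matrix (Fin n) (Fin n) ℝ) :
    mixedDisc n A = ∑ τ : Equiv.Perm (Fin n),
      ((Equiv.Perm.sign τ : ℤ) : ℝ) * (Matrix.of fun l i => A l i (τ l)).det := by
  rw [mixedDisc_apply, Finset.sum_comm]
  refine Finset.sum_congr rfl fun τ _ => ?_
  rw [← Matrix.det_transpose, Matrix.det_apply', Finset.mul_sum]
  refine Finset.sum_congr rfl fun σ _ => ?_
  simp only [Matrix.transpose_apply, Matrix.of_apply]
  ring

theorem mixedDisc_transpose (A : Fin n → Matrix (Fin n) (Fin n) ℝ) :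
    mixedDisc n (fun l => (A l).transpose) = mixedDisc n A := by
  rw [mixedDisc_apply, mixedDisc_apply, Finset.sum_comm]
  refine Finset.sum_congr rfl fun τ _ => Finset.sum_congr rfl fun σ _ => ?_
  simp only [Matrix.transpose_apply]
  ring

/-- Cauchy–Binet formula for mixed discriminants. -/
theorem mixedDisc_transpose_mul (P Q : Fin n → Matrix (Fin n) (Fin n) ℝ) :
    mixedDisc n (fun l => (P l).transpose * Q l) = ∑ κ : Fin n → Fin n,
      (Matrix.of fun l => P l (κ l)).det * (Matrix.of fun l => Q l (κ l)).det := by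
  have h : ∀ κ : Fin n → Fin n,
      (Matrix.of fun l => P l (κ l)).det * (Matrix.of fun l => Q l (κ l)).det =
      ∑ σ : Equiv.Perm (Fin n), ∑ τ : Equiv.Perm (Fin n),
        ((Equiv.Perm.sign σ : ℤ) * (Equiv.Perm.sign τ : ℤ) : ℝ) *
          ∏ l, P l (κ l) (σ l) * Q l (κ l) (τ l) := by
    intro κ
    rw [← Matrix.det_transpose, ← Matrix.det_transpose (Matrix.of fun l => Q l (κ l)),
      Matrix.det_apply', Matrix.det_apply', Finset.sum_mul_sum]
    refine Finset.sum_congr rfl fun σ _ => Finset.sum_congr rfl fun τ _ => ?_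
    simp only [Matrix.transpose_apply, Matrix.of_apply, Finset.prod_mul_distrib]
    ring
  simp_rw [h]
  rw [mixedDisc_apply, Finset.sum_comm]
  conv_rhs => rw [Finset.sum_comm]
  rw [Finset.sum_comm]
  refine Finset.sum_congr rfl fun σ _ => ?_
  conv_rhs => rw [Finset.sum_comm]
  refine Finset.sum_congr rfl fun τ _ => ?_
  rw [← Finset.mul_sum]
  congr 1
  simp only [Matrix.mul_apply, Matrix.transpose_apply]
  rw [Finset.prod_univ_sum]
  simp

theorem mixedDisc_vecMulVec (a b : Fin n → Fin n → ℝ) :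
    mixedDisc n (fun l => Matrix.vecMulVec (a l) (b l)) =
      (Matrix.of a).det * (Matrix.of b).det := by
  rw [← Matrix.det_transpose, ← Matrix.det_transpose (Matrix.of b), Matrix.det_apply',
    Matrix.det_apply', Finset.sum_mul_sum, mixedDisc_apply]
  refine Finset.sum_congr rfl fun σ _ => Finset.sum_congr rfl fun τ _ => ?_
  simp only [Matrix.transpose_apply, Matrix.of_apply, Matrix.vecMulVec_apply,
    Finset.prod_mul_distrib]
  ring

open scoped MatrixOrder Matrix.Norms.L2Operator in
theorem exists_eq_transpose_mul_self {A : Matrix (Fin n) (Fin n) ℝ} (hA : A.PosSemidef) :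
    ∃ C : Matrix (Fin n) (Fin n) ℝ, A = C.transpose * C := by
  obtain ⟨C, hC⟩ := CStarAlgebra.nonneg_iff_eq_star_mul_self.mp hA.nonneg
  exact ⟨C, by simpa [Matrix.star_eq_conjTranspose] using hC⟩

theorem mixedDisc_nonneg {A : Fin n → Matrix (Fin n) (Fin n) ℝ} (hA : ∀ l, (A l).PosSemidef) :
    0 ≤ mixedDisc n A := by
  choose C hC using fun l => exists_eq_transpose_mul_self (hA l)
  obtain rfl : A = fun l => (C l).transpose * C l := funext hC
  rw [mixedDisc_transpose_mul]
  exact Finset.sum_nonneg fun κ _ => mul_self_nonneg _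

theorem mixedDisc_update_mono {A : Fin n → Matrix (Fin n) (Fin n) ℝ} (m : Fin n)
    (hA : ∀ l ≠ m, (A l).PosSemidef) {B C : Matrix (Fin n) (Fin n) ℝ}
    (hBC : (C - B).PosSemidef) :
    mixedDisc n (Function.update A m B) ≤ mixedDisc n (Function.update A m C) := by
  rw [← sub_nonneg, ← MultilinearMap.map_update_sub]
  refine mixedDisc_nonneg fun l => ?_
  by_cases h : l = m
  · subst h; simpa using hBC
  · simpa [Function.update_of_ne h] using hA l h

/-- The mixed discriminant is monotone on positive semidefinite matrices: the matrices are replaced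
one slot at a time. -/
theorem mixedDisc_mono {A B : Fin n → Matrix (Fin n) (Fin n) ℝ} (hA : ∀ l, (A l).PosSemidef)
    (hAB : ∀ l, (B l - A l).PosSemidef) : mixedDisc n A ≤ mixedDisc n B := by
  have hB : ∀ l, (B l).PosSemidef := fun l => by simpa using (hA l).add (hAB l)
  suffices h : ∀ s : Finset (Fin n), mixedDisc n A ≤ mixedDisc n (s.piecewise B A) by
    simpa using h Finset.univ
  intro s
  induction s using Finset.induction_on with
  | empty => simp
  | insert m s hm ih =>
    refine ih.trans ?_
    rw [Finset.piecewise_insert]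
    conv_lhs => rw [← Function.update_eq_self m (s.piecewise B A)]
    refine mixedDisc_update_mono m (fun l _ => ?_) ?_
    · by_cases h : l ∈ s <;> simp [h, hA, hB]
    · simpa [hm] using hAB m

/-- A matrix which does not increase the Euclidean norm. -/
def IsContraction (B : Matrix (Fin n) (Fin n) ℝ) : Prop :=
  (1 - B.transpose * B).PosSemidef

theorem isContraction_one : IsContraction (1 : Matrix (Fin n) (Fin n) ℝ) := by
  simpa [IsContraction] using Matrix.PosSemidef.zero

theorem isContraction_of_sum_sq_le {B : Matrix (Fin n) (Fin n) ℝ}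
    (hB : ∑ i, ∑ j, B i j ^ 2 ≤ 1) : IsContraction B := by
  refine Matrix.PosSemidef.of_dotProduct_mulVec_nonneg ?_ fun v => ?_
  · simp [Matrix.IsHermitian, Matrix.transpose_mul]
  · have h1 : star v ⬝ᵥ (1 - B.transpose * B).mulVec v
        = ∑ j, v j ^ 2 - ∑ i, (∑ j, B i j * v j) ^ 2 := by
      rw [Matrix.sub_mulVec, dotProduct_sub, ← Matrix.mulVec_mulVec,
        Matrix.dotProduct_transpose_mulVec, Matrix.one_mulVec]
      simp [dotProduct, Matrix.mulVec, sq]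
    rw [h1, sub_nonneg]
    calc ∑ i, (∑ j, B i j * v j) ^ 2
        ≤ ∑ i, (∑ j, B i j ^ 2) * ∑ j, v j ^ 2 :=
          Finset.sum_le_sum fun i _ => Finset.sum_mul_sq_le_sq_mul_sq _ _ _
      _ = (∑ i, ∑ j, B i j ^ 2) * ∑ j, v j ^ 2 := by rw [Finset.sum_mul]
      _ ≤ 1 * ∑ j, v j ^ 2 := by gcongr
      _ = _ := one_mul _

/-- The key positivity estimate: against positive semidefinite matrices in the slots `l ∈ s`, the
mixed discriminant of arbitrary contractions in the other slots is dominated by the one of identity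
matrices. -/
theorem abs_mixedDisc_piecewise_le (s : Finset (Fin n)) {A B : Fin n → Matrix (Fin n) (Fin n) ℝ}
    (hA : ∀ l ∈ s, (A l).PosSemidef) (hB : ∀ l ∉ s, IsContraction (B l)) :
    |mixedDisc n (s.piecewise A B)| ≤ mixedDisc n (s.piecewise A 1) := by
  have h : ∀ l, ∃ C : Matrix (Fin n) (Fin n) ℝ, l ∈ s → A l = C.transpose * C := fun l => by
    by_cases hl : l ∈ s
    · obtain ⟨C, hC⟩ := exists_eq_transpose_mul_self (hA l hl)
      exact ⟨C, fun _ => hC⟩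
    · exact ⟨0, fun h => absurd h hl⟩
  choose C hC using h
  set P := s.piecewise C 1
  set Q := s.piecewise C B
  have h1 : s.piecewise A B = fun l => (P l).transpose * Q l := by
    ext1 l
    by_cases hl : l ∈ s <;> simp [P, Q, hl, hC]
  have h2 : s.piecewise A 1 = fun l => (P l).transpose * P l := by
    ext1 l
    by_cases hl : l ∈ s <;> simp [P, hl, hC]
  have h3 : mixedDisc n (fun l => (Q l).transpose * Q l) ≤ mixedDisc n (s.piecewise A 1) := by
    refine mixedDisc_mono (fun l => ?_) fun l => ?_
    · simpa using Matrix.posSemidef_conjTranspose_mul_self (Q l)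
    · by_cases hl : l ∈ s
      · simpa [Q, hl, hC] using Matrix.PosSemidef.zero
      · simpa [Q, hl, IsContraction] using hB l hl
  have h4 : |mixedDisc n (s.piecewise A B)| ≤ (mixedDisc n (s.piecewise A 1) +
      mixedDisc n (fun l => (Q l).transpose * Q l)) / 2 := by
    rw [h1, h2, mixedDisc_transpose_mul, mixedDisc_transpose_mul, mixedDisc_transpose_mul,
      ← Finset.sum_add_distrib, Finset.sum_div]
    refine (Finset.abs_sum_le_sum_abs _ _).trans (Finset.sum_le_sum fun κ _ => ?_)
    rw [abs_le]
    constructor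
    · nlinarith [sq_nonneg ((Matrix.of fun l => P l (κ l)).det + (Matrix.of fun l => Q l (κ l)).det)]
    · nlinarith [sq_nonneg ((Matrix.of fun l => P l (κ l)).det - (Matrix.of fun l => Q l (κ l)).det)]
  linarith

/-- The same estimate with a matrix of arbitrary size in one of the slots. -/
theorem abs_mixedDisc_update_piecewise_le (s : Finset (Fin n)) {m : Fin n} (hm : m ∉ s)
    {A B : Fin n → Matrix (Fin n) (Fin n) ℝ}
    (hA : ∀ l ∈ s, (A l).PosSemidef) (hB : ∀ l ∉ s, l ≠ m → IsContraction (B l))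
    {c : ℝ} (hc : 0 ≤ c) {H : Matrix (Fin n) (Fin n) ℝ} (hH : ∀ i j, |H i j| ≤ c) :
    |mixedDisc n (Function.update (s.piecewise A B) m H)| ≤
      n * c * mixedDisc n (s.piecewise A 1) := by
  have hn : (0 : ℝ) < n := by
    have := m.pos
    exact_mod_cast this
  rcases hc.eq_or_lt with rfl | hc
  · have : H = 0 := by
      ext i j
      simpa using hH i j
    simp [this]
  · have h1 : H = (n * c) • ((n * c)⁻¹ • H) := by
      rw [smul_smul, mul_inv_cancel₀ (by positivity), one_smul]
    rw [h1, MultilinearMap.map_update_smul, smul_eq_mul, abs_mul, abs_of_pos (by positivity)]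
    gcongr
    have h2 : Function.update (s.piecewise A B) m ((n * c)⁻¹ • H) =
        s.piecewise A (Function.update B m ((n * c)⁻¹ • H)) := by
      ext1 l
      by_cases hl : l = m
      · subst hl; simp [hm]
      · by_cases h : l ∈ s <;> simp [h, hl]
    rw [h2]
    refine abs_mixedDisc_piecewise_le s hA fun l hl => ?_
    by_cases h : l = m
    · subst h
      rw [Function.update_self]
      refine isContraction_of_sum_sq_le ?_
      calc ∑ i, ∑ j, (((n : ℝ) * c)⁻¹ • H) i j ^ 2 ≤ ∑ i : Fin n, ∑ j : Fin n, ((n : ℝ)⁻¹) ^ 2 := by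
            refine Finset.sum_le_sum fun i _ => Finset.sum_le_sum fun j _ => ?_
            have h0 : (0 : ℝ) < ((n : ℝ) * c)⁻¹ := by positivity
            rw [sq_le_sq, Matrix.smul_apply, smul_eq_mul, abs_mul, abs_of_pos h0,
              abs_of_pos (inv_pos.2 hn), mul_inv, mul_assoc]
            have : c⁻¹ * |H i j| ≤ 1 := by
              rw [inv_mul_le_iff₀ hc]; simpa using hH i j
            calc (n : ℝ)⁻¹ * (c⁻¹ * |H i j|) ≤ (n : ℝ)⁻¹ * 1 := by gcongr
              _ = _ := mul_one _
        _ = 1 := by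
            simp only [Finset.sum_const, Finset.card_univ, Fintype.card_fin, nsmul_eq_mul]
            field_simp
        _ ≤ 1 := le_rfl
    · rw [Function.update_of_ne h]
      exact hB l hl h

/-- A mixed discriminant vanishes when too many of the matrices have a common kernel. -/
theorem mixedDisc_eq_zero_of_kernel (s : Finset (Fin n)) (A : Fin n → Matrix (Fin n) (Fin n) ℝ)
    (W : Submodule ℝ (V n)) (hW : n < Module.finrank ℝ W + s.card)
    (hA : ∀ l ∈ s, ∀ w ∈ W, ∀ j, ∑ i, A l i j * w i = 0) : mixedDisc n A = 0 := by
  rw [mixedDisc_eq_sum_det]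
  refine Finset.sum_eq_zero fun τ _ => ?_
  suffices h : (Matrix.of fun l i => A l i (τ l)).det = 0 by rw [h, mul_zero]
  rw [← Matrix.exists_mulVec_eq_zero_iff]
  let φ : W →ₗ[ℝ] ((sᶜ : Finset (Fin n)) → ℝ) :=
    { toFun := fun w l => ∑ i, A l i (τ l) * (w : V n) i
      map_add' := fun v w => by
        ext l; simp [mul_add, Finset.sum_add_distrib]
      map_smul' := fun c w => by
        ext l; simp [Finset.mul_sum, mul_left_comm] }
  have hφ : LinearMap.ker φ ≠ ⊥ := by
    refine LinearMap.ker_ne_bot_of_finrank_lt ?_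
    have h1 := Finset.card_compl_add_card s
    simp only [Fintype.card_fin] at h1
    simp only [Module.finrank_fintype_fun_eq_card, Fintype.card_coe]
    omega
  obtain ⟨w, hw, hw0⟩ := (Submodule.ne_bot_iff _).1 hφ
  refine ⟨fun i => (w : V n) i, fun h => hw0 ?_, ?_⟩
  · ext i
    exact congrFun h i
  · ext l
    simp only [Matrix.mulVec, dotProduct, Matrix.of_apply, Pi.zero_apply]
    by_cases hl : l ∈ s
    · exact hA l hl w w.2 _
    · exact congrFun (LinearMap.mem_ker.1 hw) ⟨l, by simpa using hl⟩

/-! ### The top coefficient of a product of `(1,1)`-forms -/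

/-- The `(1,1)`-form `∑ A_{ij} dx_i ∧ dξ_j` with matrix of coefficients `A`. -/
noncomputable def formOf (n : ℕ) : Matrix (Fin n) (Fin n) ℝ →ₗ[ℝ] FormAlg n :=
  ∑ i, ∑ j, (Matrix.entryLinearMap ℝ ℝ i j).smulRight (dx i * dxi j)

theorem formOf_apply (A : Matrix (Fin n) (Fin n) ℝ) :
    formOf n A = ∑ i, ∑ j, A i j • (dx i * dxi j) := by
  simp [formOf]

theorem formOf_single (i j : Fin n) :
    formOf n (Matrix.single i j 1) = dx i * dxi j := by
  rw [formOf_apply, Finset.sum_eq_single i, Finset.sum_eq_single j]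
  · simp
  · intro b _ hb
    simp [hb.symm]
  · simp
  · intro b _ hb
    simp [hb.symm]
  · simp

/-- A product of pairs is an alternating product of twice as many factors. -/
theorem prod_ofFn_mul_pair {M : Type*} [AddCommGroup M] [Module ℝ M] (q : ℕ)
    (v : Fin q → Fin 2 → M) :
    (List.ofFn fun i => ExteriorAlgebra.ι ℝ (v i 0) * ExteriorAlgebra.ι ℝ (v i 1)).prod =
      ExteriorAlgebra.ιMulti ℝ (q * 2) fun k =>
        v (finProdFinEquiv.symm k).1 (finProdFinEquiv.symm k).2 := by
  rw [ExteriorAlgebra.ιMulti_apply, List.ofFn_mul, List.prod_flatten, List.map_ofFn]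
  congr 2
  funext i
  have h : ∀ j : Fin 2, finProdFinEquiv.symm
      (⟨(i : ℕ) * 2 + j, by omega⟩ : Fin (q * 2)) = (i, j) := fun j => by
    rw [Equiv.symm_apply_eq]
    ext
    simp [finProdFinEquiv]
    ring
  simp only [Function.comp, h]
  simp [List.ofFn_succ]

/-- The interleaved order `dx_1, dξ_1, …, dx_n, dξ_n` makes the determinant block diagonal, so that no
sign appears. -/
theorem topCoeff_prod_pair (a b : Fin n → Fin n → ℝ) :
    topCoeff n (List.ofFn fun l =>
      ExteriorAlgebra.ι ℝ (fun k : Fin n × Fin 2 => if k.2 = 0 then a l k.1 else 0) *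
      ExteriorAlgebra.ι ℝ (fun k : Fin n × Fin 2 => if k.2 = 0 then 0 else b l k.1)).prod =
      (Matrix.of a).det * (Matrix.of b).det := by
  have h := prod_ofFn_mul_pair n (fun (l : Fin n) (e : Fin 2) (k : Fin n × Fin 2) =>
    if e = 0 then (if k.2 = 0 then a l k.1 else 0) else (if k.2 = 0 then 0 else b l k.1))
  simp only [↓reduceIte, one_ne_zero] at h
  rw [h, topCoeff, ExteriorAlgebra.liftAlternating_apply_ιMulti, Function.update_self,
    Module.Basis.det_apply, ← Matrix.det_transpose,
    ← Matrix.det_submatrix_equiv_self finProdFinEquiv]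
  have h2 : (Matrix.transpose (Module.Basis.toMatrix
        ((Pi.basisFun ℝ (Fin n × Fin 2)).reindex finProdFinEquiv) fun k =>
          (fun (l : Fin n) (e : Fin 2) (k : Fin n × Fin 2) =>
    if e = 0 then (if k.2 = 0 then a l k.1 else 0) else (if k.2 = 0 then 0 else b l k.1))
            (finProdFinEquiv.symm k).1 (finProdFinEquiv.symm k).2)).submatrix
        finProdFinEquiv finProdFinEquiv =
      Matrix.blockDiagonal fun e : Fin 2 => if e = 0 then Matrix.of a else Matrix.of b := by
    ext ⟨l, e⟩ ⟨k, e'⟩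
    simp only [Matrix.submatrix_apply, Matrix.transpose_apply, Module.Basis.toMatrix_apply,
      Module.Basis.repr_reindex_apply, Equiv.symm_apply_apply, Pi.basisFun_repr,
      Matrix.blockDiagonal_apply]
    fin_cases e <;> fin_cases e' <;> simp
  rw [h2, Matrix.det_blockDiagonal]
  simp [Fin.prod_univ_two]

/-- A product of `n` forms of bidegree `(1,1)` has the mixed discriminant of their matrices as top
coefficient. By multilinearity it suffices to compare the values on the forms `dx_i ∧ dξ_j`. -/
theorem topCoeff_prod_formOf (A : Fin n → Matrix (Fin n) (Fin n) ℝ) :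
    topCoeff n (List.ofFn fun l => formOf n (A l)).prod = mixedDisc n A := by
  have h : (topCoeff n).compMultilinearMap
      ((MultilinearMap.mkPiAlgebraFin ℝ n (FormAlg n)).compLinearMap fun _ => formOf n) =
      mixedDisc n := by
    refine Module.Basis.ext_multilinear (fun _ => Matrix.stdBasis ℝ (Fin n) (Fin n)) fun v => ?_
    have hb : ∀ k : Fin n × Fin n, Matrix.stdBasis ℝ (Fin n) (Fin n) k =
        Matrix.single k.1 k.2 1 := fun k => Matrix.stdBasis_eq_single ℝ k.1 k.2
    simp only [LinearMap.compMultilinearMap_apply, MultilinearMap.compLinearMap_apply,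
      MultilinearMap.mkPiAlgebraFin_apply, hb, formOf_single]
    have h1 := topCoeff_prod_pair (fun l => Pi.single (v l).1 1) (fun l => Pi.single (v l).2 1)
    rw [← mixedDisc_vecMulVec] at h1
    convert h1 using 3
    · congr 1
      funext l
      simp only [dx, dxi]
      congr 2
      · ext ⟨i, e⟩
        fin_cases e <;> simp [Pi.single_apply]
      · ext ⟨i, e⟩
        fin_cases e <;> simp [Pi.single_apply]
    · rename_i l
      ext i j
      simp only [Matrix.single_apply, Matrix.vecMulVec_apply, Pi.single_apply]
      grind
  exact DFunLike.congr_fun h A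

theorem ι_mul_ι_comm {M : Type*} [AddCommGroup M] [Module ℝ M] (x y : M) :
    ExteriorAlgebra.ι ℝ x * ExteriorAlgebra.ι ℝ y =
      -(ExteriorAlgebra.ι ℝ y * ExteriorAlgebra.ι ℝ x) :=
  eq_neg_of_add_eq_zero_left (ExteriorAlgebra.ι_add_mul_swap x y)

theorem prod_ι_mul_ι {M : Type*} [AddCommGroup M] [Module ℝ M] (l : List M) (y : M) :
    (l.map (ExteriorAlgebra.ι ℝ)).prod * ExteriorAlgebra.ι ℝ y =
      (-1 : ℝ) ^ l.length • (ExteriorAlgebra.ι ℝ y * (l.map (ExteriorAlgebra.ι ℝ)).prod) := by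
  induction l with
  | nil => simp
  | cons x l ih =>
    rw [List.map_cons, List.prod_cons, mul_assoc, ih, mul_smul_comm, ← mul_assoc, ι_mul_ι_comm x y,
      List.length_cons, pow_succ]
    simp [mul_assoc]

/-- Up to a sign, `a_1 ∧ … ∧ a_q ∧ b_1 ∧ … ∧ b_q` is `a_1 ∧ b_1 ∧ … ∧ a_q ∧ b_q`. -/
theorem exists_prod_ι_mul_prod_ι {M : Type*} [AddCommGroup M] [Module ℝ M] (q : ℕ)
    (a b : Fin q → M) : ∃ s : ℝ,
    (List.ofFn fun i => ExteriorAlgebra.ι ℝ (a i)).prod *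
      (List.ofFn fun i => ExteriorAlgebra.ι ℝ (b i)).prod =
    s • (List.ofFn fun i => ExteriorAlgebra.ι ℝ (a i) * ExteriorAlgebra.ι ℝ (b i)).prod := by
  induction q with
  | zero => exact ⟨1, by simp⟩
  | succ q ih =>
    obtain ⟨s, hs⟩ := ih (fun i => a i.succ) (fun i => b i.succ)
    have h := prod_ι_mul_ι (List.ofFn fun i => a i.succ) (b 0)
    simp only [List.map_ofFn, List.length_ofFn, Function.comp_def] at h
    refine ⟨(-1) ^ q * s, ?_⟩
    simp only [List.ofFn_succ, List.prod_cons]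
    rw [mul_assoc, ← mul_assoc _ (ExteriorAlgebra.ι ℝ (b 0)), h, smul_mul_assoc, mul_assoc _ _
      (List.prod _), hs]
    simp only [mul_smul_comm, smul_smul, mul_assoc]

theorem map_sort_eq_ofFn {X : Type*} (K : Finset (Fin n)) {q : ℕ} (h : K.card = q)
    (f : Fin n → X) : K.sort.map f = List.ofFn fun i => f (K.orderEmbOfFin h i) := by
  refine List.ext_getElem (by simp [h]) fun i h1 h2 => ?_
  simp [Finset.orderEmbOfFin_apply]

/-- The slots of the mixed discriminant which computes `dd^# f_1 ∧ … ∧ dd^# f_p ∧ α`: the first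
`p` of them receive `A`, the others `B`. -/
def slots {X : Type*} {p : ℕ} (hp : p ≤ n) (A : Fin p → X) (B : Fin (n - p) → X) (l : Fin n) : X :=
  Fin.append A B (Fin.cast (by omega) l)

theorem slots_of_lt {X : Type*} {p : ℕ} (hp : p ≤ n) (A : Fin p → X) (B : Fin (n - p) → X)
    {l : Fin n} (hl : (l : ℕ) < p) : slots hp A B l = A ⟨l, hl⟩ := by
  have : Fin.cast (by omega) l = Fin.castAdd (n - p) (⟨l, hl⟩ : Fin p) := by ext; simp
  rw [slots, this, Fin.append_left]

theorem slots_of_not_lt {X : Type*} {p : ℕ} (hp : p ≤ n) (A : Fin p → X)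
    (B : Fin (n - p) → X) {l : Fin n} (hl : ¬ (l : ℕ) < p) :
    slots hp A B l = B ⟨l - p, by omega⟩ := by
  have : Fin.cast (by omega) l = Fin.natAdd p (⟨l - p, by omega⟩ : Fin (n - p)) := by
    ext; simp; omega
  rw [slots, this, Fin.append_right]

theorem slots_comp {X Y : Type*} {p : ℕ} (hp : p ≤ n) (A : Fin p → X) (B : Fin (n - p) → X)
    (f : X → Y) (l : Fin n) : f (slots hp A B l) = slots hp (f ∘ A) (f ∘ B) l := by
  by_cases hl : (l : ℕ) < p
  · simp [slots_of_lt hp _ _ hl]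
  · simp [slots_of_not_lt hp _ _ hl]

/-- The constant matrices which a basis form `dx_K ∧ dξ_L` puts into the last slots. -/
def elemSlots {q : ℕ} (K L : MultiIndex n q) (j : Fin q) : Matrix (Fin n) (Fin n) ℝ :=
  Matrix.single (K.1.orderEmbOfFin K.2 j) (L.1.orderEmbOfFin L.2 j) 1

theorem isContraction_elemSlots {q : ℕ} (K L : MultiIndex n q) (j : Fin q) :
    IsContraction (elemSlots K L j) := by
  refine isContraction_of_sum_sq_le ?_
  rw [Finset.sum_eq_single (K.1.orderEmbOfFin K.2 j),
    Finset.sum_eq_single (L.1.orderEmbOfFin L.2 j)]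
  · simp [elemSlots]
  · intro b _ hb
    simp [elemSlots, hb.symm]
  · simp
  · intro b _ hb
    simp [elemSlots, hb.symm]
  · simp

/-- The sign `s` comes from the reordering of `dx_K ∧ dξ_L`, and does not depend on the other factors. -/
theorem exists_topCoeff_mul {p : ℕ} (hp : p ≤ n) (K L : MultiIndex n (n - p)) :
    ∃ s : ℝ, ∀ A : Fin p → Matrix (Fin n) (Fin n) ℝ,
      topCoeff n ((List.ofFn fun i => formOf n (A i)).prod * (dxMulti K.1 * dxiMulti L.1)) =
        s * mixedDisc n (slots hp A (elemSlots K L)) := by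
  obtain ⟨s, hs⟩ := exists_prod_ι_mul_prod_ι (n - p)
    (fun j => (Pi.single (K.1.orderEmbOfFin K.2 j, 0) 1 : Fin n × Fin 2 → ℝ))
    (fun j => (Pi.single (L.1.orderEmbOfFin L.2 j, 1) 1 : Fin n × Fin 2 → ℝ))
  refine ⟨s, fun A => ?_⟩
  have h1 : dxMulti K.1 * dxiMulti L.1 =
      s • (List.ofFn fun j => formOf n (elemSlots K L j)).prod := by
    simp only [elemSlots, formOf_single]
    rw [dxMulti, dxiMulti, map_sort_eq_ofFn K.1 K.2, map_sort_eq_ofFn L.1 L.2]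
    exact hs
  rw [h1, mul_smul_comm, ← List.prod_append, ← List.ofFn_fin_append, map_smul, smul_eq_mul,
    ← topCoeff_prod_formOf]
  congr 3
  have h2 : p + (n - p) = n := by omega
  simp only [slots_comp hp A (elemSlots K L) (formOf n)]
  rw [List.ofFn_congr h2]
  rfl

/-! ### Partial derivatives and Hessians -/

/-- The Hessian matrix of a function. -/
noncomputable def hess (f : V n → ℝ) (x : V n) : Matrix (Fin n) (Fin n) ℝ :=
  Matrix.of fun i j => pderiv i (pderiv j f) x

theorem ddSharp_eq (f : V n → ℝ) (x : V n) : ddSharp f x = formOf n (hess f x) := by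
  rw [formOf_apply]
  rfl

theorem contDiff_pderiv {f : V n → ℝ} (hf : ContDiff ℝ ∞ f) (i : Fin n) :
    ContDiff ℝ ∞ (pderiv i f) :=
  (hf.fderiv_right (m := ∞) (by simp)).clm_apply contDiff_const

theorem _root_.HasCompactSupport.pderiv {f : V n → ℝ} (hf : HasCompactSupport f) (i : Fin n) :
    HasCompactSupport (SuperCurrents.pderiv i f) :=
  hf.fderiv_apply ℝ _

theorem tsupport_pderiv_subset (f : V n → ℝ) (i : Fin n) : tsupport (pderiv i f) ⊆ tsupport f :=
  tsupport_fderiv_apply_subset ℝ _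

theorem differentiable_of_smooth {f : V n → ℝ} (hf : ContDiff ℝ ∞ f) : Differentiable ℝ f :=
  hf.differentiable (by simp)

theorem fderiv_fderiv_apply {f : V n → ℝ} (hf : ContDiff ℝ ∞ f) (w x v : V n) :
    fderiv ℝ (fun y => fderiv ℝ f y w) x v = fderiv ℝ (fderiv ℝ f) x v w := by
  have h : DifferentiableAt ℝ (fderiv ℝ f) x :=
    (hf.fderiv_right (m := ∞) (by simp)).differentiable (by simp) x
  rw [fderiv_clm_apply h (differentiableAt_const _)]
  simp

theorem fderiv_pderiv {f : V n → ℝ} (hf : ContDiff ℝ ∞ f) (i : Fin n) (x v : V n) :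
    fderiv ℝ (pderiv i f) x v = fderiv ℝ (fderiv ℝ f) x v (EuclideanSpace.single i 1) :=
  fderiv_fderiv_apply hf _ x v

theorem hasDerivAt_comp_line {F : V n → ℝ} (hF : Differentiable ℝ F) (x w : V n) (t : ℝ) :
    HasDerivAt (fun t : ℝ => F (x + t • w)) (fderiv ℝ F (x + t • w) w) t := by
  have hline : HasDerivAt (fun t : ℝ => x + t • w) w t := by
    simpa using ((hasDerivAt_id t).smul_const w).const_add x
  exact (hF _).hasFDerivAt.comp_hasDerivAt t hline

theorem pderiv_comm {f : V n → ℝ} (hf : ContDiff ℝ ∞ f) (i j : Fin n) :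
    pderiv i (pderiv j f) = pderiv j (pderiv i f) := by
  ext x
  have h : IsSymmSndFDerivAt ℝ f x := hf.contDiffAt.isSymmSndFDerivAt
    (by rw [minSmoothness_of_isRCLikeNormedField]; exact WithTop.coe_le_coe.2 le_top)
  change fderiv ℝ (pderiv j f) x _ = fderiv ℝ (pderiv i f) x _
  rw [fderiv_pderiv hf, fderiv_pderiv hf]
  exact h _ _

theorem pderiv_mul {f g : V n → ℝ} (hf : Differentiable ℝ f) (hg : Differentiable ℝ g) (i : Fin n)
    (x : V n) : pderiv i (fun y => f y * g y) x = f x * pderiv i g x + g x * pderiv i f x := by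
  simp [pderiv, fderiv_fun_mul (hf x) (hg x)]

theorem pderiv_prod {ι : Type*} [DecidableEq ι] (s : Finset ι) {f : ι → V n → ℝ}
    (hf : ∀ l ∈ s, Differentiable ℝ (f l)) (i : Fin n) (x : V n) :
    pderiv i (fun y => ∏ l ∈ s, f l y) x =
      ∑ l ∈ s, (∏ l' ∈ s.erase l, f l' x) * pderiv i (f l) x := by
  simp only [pderiv]
  rw [fderiv_finsetProd fun l hl => hf l hl x]
  simp [sum_apply]

theorem pderiv_sub {f g : V n → ℝ} (hf : Differentiable ℝ f) (hg : Differentiable ℝ g)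
    (i : Fin n) : pderiv i (fun y => f y - g y) = fun x => pderiv i f x - pderiv i g x := by
  ext x
  simp [pderiv, fderiv_fun_sub (hf x) (hg x)]

theorem hess_sub {f g : V n → ℝ} (hf : ContDiff ℝ ∞ f) (hg : ContDiff ℝ ∞ g) (x : V n) :
    hess (fun y => f y - g y) x = hess f x - hess g x := by
  ext i j
  simp only [hess, Matrix.of_apply, Matrix.sub_apply]
  rw [pderiv_sub (differentiable_of_smooth hf) (differentiable_of_smooth hg),
    pderiv_sub (differentiable_of_smooth (contDiff_pderiv hf j))
      (differentiable_of_smooth (contDiff_pderiv hg j))]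

theorem hess_transpose {f : V n → ℝ} (hf : ContDiff ℝ ∞ f) (x : V n) :
    (hess f x).transpose = hess f x := by
  ext i j
  exact congrFun (pderiv_comm hf j i) x

theorem integral_pderiv_eq_zero {f : V n → ℝ} (hf : ContDiff ℝ ∞ f) (hc : HasCompactSupport f)
    (i : Fin n) : ∫ x, pderiv i f x = 0 := by
  have h := integral_mul_fderiv_eq_neg_fderiv_mul_of_integrable (μ := (volume : Measure (V n)))
    (f := fun _ => (1 : ℝ)) (g := f) (v := EuclideanSpace.single i 1) (by simp)
    (by
      simp only [one_mul]
      exact (contDiff_pderiv hf i).continuous.integrable_of_hasCompactSupport (hc.pderiv i))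
    (by
      simp only [one_mul]
      exact hf.continuous.integrable_of_hasCompactSupport hc)
    (fun x _ => differentiableAt_const _) (fun x _ => differentiable_of_smooth hf x)
  have h' : ∫ x, fderiv ℝ f x (EuclideanSpace.single i 1) = 0 := by simpa using h
  exact h'

theorem sum_sum_hess {f : V n → ℝ} (hf : ContDiff ℝ ∞ f) (x v w : V n) :
    ∑ i, ∑ j, v i * hess f x i j * w j = fderiv ℝ (fderiv ℝ f) x v w := by
  have hsum : ∀ v : V n, v = ∑ i, v i • EuclideanSpace.single i (1 : ℝ) := fun v => by
    ext j
    simp [Pi.single_apply]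
  conv_rhs => rw [hsum v, hsum w]
  simp only [map_sum, map_smul, sum_apply, smul_apply, smul_eq_mul, Finset.mul_sum]
  rw [Finset.sum_comm]
  refine Finset.sum_congr rfl fun j _ => Finset.sum_congr rfl fun i _ => ?_
  simp only [hess, Matrix.of_apply]
  rw [show pderiv i (pderiv j f) x = _ from fderiv_pderiv hf j x _]
  ring

/-- The value of the Hessian form at `w` is the derivative of the slope of `f` along the line
through `x` with direction `w`, which is monotone. -/
theorem posSemidef_hess {f : V n → ℝ} (hf : ContDiff ℝ ∞ f) (hconv : ConvexOn ℝ univ f) (x : V n) :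
    (hess f x).PosSemidef := by
  refine Matrix.PosSemidef.of_dotProduct_mulVec_nonneg ?_ fun v => ?_
  · simpa [Matrix.IsHermitian] using hess_transpose hf x
  · have h1 : star v ⬝ᵥ (hess f x).mulVec v =
        fderiv ℝ (fderiv ℝ f) x (WithLp.toLp 2 v) (WithLp.toLp 2 v) := by
      rw [← sum_sum_hess hf]
      simp [dotProduct, Matrix.mulVec, Finset.mul_sum, mul_assoc]
    rw [h1]
    set w : V n := WithLp.toLp 2 v
    have hd1 := hasDerivAt_comp_line (differentiable_of_smooth hf) x w
    have hd2 := hasDerivAt_comp_line (differentiable_of_smooth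
      ((hf.fderiv_right (m := ∞) (by simp)).clm_apply (contDiff_const (c := w)))) x w 0
    rw [zero_smul, add_zero, fderiv_fderiv_apply hf] at hd2
    have hconv1 : ConvexOn ℝ univ fun t : ℝ => f (x + t • w) := by
      refine ⟨convex_univ, fun a _ b _ s t hs ht hst => ?_⟩
      have := hconv.2 (mem_univ (x + a • w)) (mem_univ (x + b • w)) hs ht hst
      convert this using 2
      rw [smul_add, smul_add, add_add_add_comm, ← add_smul, hst, one_smul, smul_smul, smul_smul,
        ← add_smul]
      rfl
    have hmono : Monotone fun t : ℝ => fderiv ℝ f (x + t • w) w := by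
      have h2 := hconv1.monotoneOn_deriv fun t _ => (hd1 t).differentiableAt
      intro a b hab
      have := h2 (mem_univ a) (mem_univ b) hab
      rwa [(hd1 a).deriv, (hd1 b).deriv] at this
    rw [← hd2.deriv]
    exact hmono.deriv_nonneg

theorem continuous_mixedDisc {X : Type*} [TopologicalSpace X]
    {A : Fin n → X → Matrix (Fin n) (Fin n) ℝ} (hA : ∀ l i j, Continuous fun x => A l x i j) :
    Continuous fun x => mixedDisc n fun l => A l x := by
  simp only [mixedDisc_apply]
  fun_prop

/-! ### Stokes' formula for mixed discriminants -/

/-- A smooth field of matrices `A` such that the `(1,1)`-form `∑ A_{ij} dx_i ∧ dξ_j` is closed for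
both differentials `d` and `d^#`. -/
structure IsClosedField (A : V n → Matrix (Fin n) (Fin n) ℝ) : Prop where
  contDiff : ∀ j k, ContDiff ℝ ∞ fun x => A x j k
  pderiv_row : ∀ i j k x, pderiv i (fun y => A y j k) x = pderiv j (fun y => A y i k) x
  pderiv_col : ∀ i j k x, pderiv i (fun y => A y j k) x = pderiv k (fun y => A y j i) x

theorem IsClosedField.transpose {A : V n → Matrix (Fin n) (Fin n) ℝ} (hA : IsClosedField A) :
    IsClosedField fun x => (A x).transpose :=
  ⟨fun j k => hA.contDiff k j, fun i j k x => hA.pderiv_col i k j x,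
    fun i j k x => hA.pderiv_row i k j x⟩

theorem isClosedField_const (B : Matrix (Fin n) (Fin n) ℝ) : IsClosedField fun _ : V n => B :=
  ⟨fun _ _ => contDiff_const, fun _ _ _ _ => by simp [pderiv], fun _ _ _ _ => by simp [pderiv]⟩

theorem isClosedField_hess {f : V n → ℝ} (hf : ContDiff ℝ ∞ f) : IsClosedField (hess f) where
  contDiff j k := contDiff_pderiv (contDiff_pderiv hf k) j
  pderiv_row i j k x := congrFun (pderiv_comm (contDiff_pderiv hf k) i j) x
  pderiv_col i j k x := by
    change pderiv i (pderiv j (pderiv k f)) x = pderiv k (pderiv j (pderiv i f)) x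
    rw [pderiv_comm hf j k, pderiv_comm hf j i, pderiv_comm (contDiff_pderiv hf j) i k]

/-- The derivatives of the closed fields cancel in a Stokes computation, because exchanging two
rows changes the sign of the permutation. -/
theorem sum_sign_mul_pderiv_eq_zero {A : Fin n → V n → Matrix (Fin n) (Fin n) ℝ} {l m : Fin n}
    (hlm : l ≠ m) (hA : IsClosedField (A l)) (τ : Equiv.Perm (Fin n)) (x : V n) :
    ∑ σ : Equiv.Perm (Fin n), ((Equiv.Perm.sign σ : ℤ) : ℝ) *
      ((∏ l' ∈ (Finset.univ.erase m).erase l, A l' x (σ l') (τ l')) *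
        pderiv (σ m) (fun y => A l y (σ l) (τ l)) x) = 0 := by
  set S := ∑ σ : Equiv.Perm (Fin n), ((Equiv.Perm.sign σ : ℤ) : ℝ) *
      ((∏ l' ∈ (Finset.univ.erase m).erase l, A l' x (σ l') (τ l')) *
        pderiv (σ m) (fun y => A l y (σ l) (τ l)) x) with hS
  -- Replacing `σ` by `σ * swap l m` exchanges the indices of the rows `l` and `m`.
  have h : S = -S := by
    conv_lhs => rw [hS, ← Equiv.sum_comp (Equiv.mulRight (Equiv.swap l m))]
    rw [hS, ← Finset.sum_neg_distrib]
    refine Finset.sum_congr rfl fun σ _ => ?_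
    have h1 : ∏ l' ∈ (Finset.univ.erase m).erase l, A l' x ((σ * Equiv.swap l m) l') (τ l') =
        ∏ l' ∈ (Finset.univ.erase m).erase l, A l' x (σ l') (τ l') := by
      refine Finset.prod_congr rfl fun l' hl' => ?_
      simp only [Finset.mem_erase] at hl'
      rw [Equiv.Perm.mul_apply, Equiv.swap_apply_of_ne_of_ne hl'.1 hl'.2.1]
    simp only [Equiv.coe_mulRight]
    rw [h1, Equiv.Perm.sign_mul, Equiv.Perm.sign_swap hlm, Equiv.Perm.mul_apply,
      Equiv.Perm.mul_apply, Equiv.swap_apply_left, Equiv.swap_apply_right, hA.pderiv_row]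
    simp
  linarith

/-- Stokes' formula for a matrix `(∂_i w_j)`: the integrand is the divergence of a field with compact
support, since the other entries are closed. -/
theorem integral_mixedDisc_update_pderiv_row {A : Fin n → V n → Matrix (Fin n) (Fin n) ℝ}
    {m : Fin n} (hA : ∀ l ≠ m, IsClosedField (A l)) {w : Fin n → V n → ℝ}
    (hw : ∀ j, ContDiff ℝ ∞ (w j)) (hc : ∀ j, HasCompactSupport (w j)) :
    ∫ x, mixedDisc n (Function.update (fun l => A l x) m
      (Matrix.of fun i j => pderiv i (w j) x)) = 0 := by
  let G : Equiv.Perm (Fin n) → Equiv.Perm (Fin n) → V n → ℝ := fun σ τ y =>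
    w (τ m) y * ∏ l ∈ Finset.univ.erase m, A l y (σ l) (τ l)
  have hprod : ∀ σ τ : Equiv.Perm (Fin n),
      ContDiff ℝ ∞ fun y => ∏ l ∈ Finset.univ.erase m, A l y (σ l) (τ l) := fun σ τ =>
    contDiff_prod fun l hl => (hA l (Finset.ne_of_mem_erase hl)).contDiff _ _
  have hG : ∀ σ τ, ContDiff ℝ ∞ (G σ τ) := fun σ τ => (hw _).mul (hprod σ τ)
  have hGc : ∀ σ τ, HasCompactSupport (G σ τ) := fun σ τ => (hc _).mul_right
  have hGd : ∀ σ τ x, pderiv (σ m) (G σ τ) x =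
      w (τ m) x * (∑ l ∈ Finset.univ.erase m,
        (∏ l' ∈ (Finset.univ.erase m).erase l, A l' x (σ l') (τ l')) *
          pderiv (σ m) (fun y => A l y (σ l) (τ l)) x) +
      ∏ l, Function.update (fun l => A l x) m (Matrix.of fun i j => pderiv i (w j) x) l
        (σ l) (τ l) := by
    intro σ τ x
    rw [pderiv_mul (differentiable_of_smooth (hw _)) (differentiable_of_smooth (hprod σ τ)),
      pderiv_prod _ fun l hl =>
        differentiable_of_smooth ((hA l (Finset.ne_of_mem_erase hl)).contDiff _ _)]
    congr 1
    rw [← Finset.mul_prod_erase _ _ (Finset.mem_univ m), Function.update_self, Matrix.of_apply,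
      mul_comm]
    congr 1
    refine Finset.prod_congr rfl fun l hl => ?_
    rw [Function.update_of_ne (Finset.ne_of_mem_erase hl)]
  have hpoint : ∀ x, mixedDisc n (Function.update (fun l => A l x) m
      (Matrix.of fun i j => pderiv i (w j) x)) =
      ∑ τ : Equiv.Perm (Fin n), ∑ σ : Equiv.Perm (Fin n),
        ((Equiv.Perm.sign σ : ℤ) * (Equiv.Perm.sign τ : ℤ) : ℝ) * pderiv (σ m) (G σ τ) x := by
    intro x
    rw [mixedDisc_apply, Finset.sum_comm]
    refine Finset.sum_congr rfl fun τ _ => ?_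
    simp only [hGd, mul_add, Finset.sum_add_distrib]
    rw [right_eq_add]
    have h0 : ∀ l ∈ Finset.univ.erase m, ∑ σ : Equiv.Perm (Fin n),
        ((Equiv.Perm.sign σ : ℤ) : ℝ) *
          ((∏ l' ∈ (Finset.univ.erase m).erase l, A l' x (σ l') (τ l')) *
            pderiv (σ m) (fun y => A l y (σ l) (τ l)) x) = 0 := fun l hl =>
      sum_sign_mul_pderiv_eq_zero (Finset.ne_of_mem_erase hl)
        (hA l (Finset.ne_of_mem_erase hl)) τ x
    have h1 := Finset.sum_eq_zero h0
    rw [Finset.sum_comm] at h1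
    have h2 := congrArg (fun t => ((Equiv.Perm.sign τ : ℤ) : ℝ) * w (τ m) x * t) h1
    simp only [mul_zero] at h2
    rw [← h2, Finset.mul_sum]
    refine Finset.sum_congr rfl fun σ _ => ?_
    rw [← Finset.mul_sum]
    ring
  simp_rw [hpoint]
  have hint : ∀ σ τ : Equiv.Perm (Fin n), Integrable fun x =>
      ((Equiv.Perm.sign σ : ℤ) * (Equiv.Perm.sign τ : ℤ) : ℝ) * pderiv (σ m) (G σ τ) x :=
    fun σ τ => ((contDiff_pderiv (hG σ τ) _).continuous.integrable_of_hasCompactSupport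
      ((hGc σ τ).pderiv _)).const_mul _
  rw [integral_finsetSum _ fun τ _ => integrable_finsetSum _ fun σ _ => hint σ τ]
  refine Finset.sum_eq_zero fun τ _ => ?_
  rw [integral_finsetSum _ fun σ _ => hint σ τ]
  refine Finset.sum_eq_zero fun σ _ => ?_
  rw [integral_const_mul, integral_pderiv_eq_zero (hG σ τ) (hGc σ τ), mul_zero]

theorem integral_mixedDisc_update_pderiv_col {A : Fin n → V n → Matrix (Fin n) (Fin n) ℝ}
    {m : Fin n} (hA : ∀ l ≠ m, IsClosedField (A l)) {w : Fin n → V n → ℝ}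
    (hw : ∀ j, ContDiff ℝ ∞ (w j)) (hc : ∀ j, HasCompactSupport (w j)) :
    ∫ x, mixedDisc n (Function.update (fun l => A l x) m
      (Matrix.of fun i j => pderiv j (w i) x)) = 0 := by
  rw [← integral_mixedDisc_update_pderiv_row (fun l hl => (hA l hl).transpose) hw hc]
  congr 1
  ext x
  rw [← mixedDisc_transpose]
  congr 1
  funext l
  by_cases h : l = m
  · subst h
    simp only [Function.update_self]
    rfl
  · simp [Function.update_of_ne h]

theorem continuous_mixedDisc_update {A : Fin n → V n → Matrix (Fin n) (Fin n) ℝ}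
    {m : Fin n} (hA : ∀ l ≠ m, IsClosedField (A l)) {H : V n → Matrix (Fin n) (Fin n) ℝ}
    (hH : ∀ i j, Continuous fun x => H x i j) :
    Continuous fun x => mixedDisc n (Function.update (fun l => A l x) m (H x)) := by
  have : ∀ x, Function.update (fun l => A l x) m (H x) =
      fun l => Function.update A m H l x := fun x => by
    funext l
    by_cases h : l = m
    · subst h; simp
    · simp [Function.update_of_ne h]
  simp_rw [this]
  refine continuous_mixedDisc fun l i j => ?_
  by_cases h : l = m
  · subst h; simpa using hH i j
  · simpa [Function.update_of_ne h] using ((hA l h).contDiff i j).continuous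

theorem hess_eq_zero_of_notMem {φ : V n → ℝ} {x : V n} (hx : x ∉ tsupport φ) : hess φ x = 0 := by
  ext i j
  exact image_eq_zero_of_notMem_tsupport (f := pderiv i (pderiv j φ)) fun h =>
    hx (tsupport_pderiv_subset φ j (tsupport_pderiv_subset _ i h))

theorem continuous_hess {φ : V n → ℝ} (hφ : ContDiff ℝ ∞ φ) (i j : Fin n) :
    Continuous fun x => hess φ x i j :=
  (contDiff_pderiv (contDiff_pderiv hφ j) i).continuous

/-- Integration by parts: `∫ φ dd^# u ∧ Θ = ∫ u dd^# φ ∧ Θ` for closed `Θ`. -/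
theorem integral_mul_mixedDisc_hess {A : Fin n → V n → Matrix (Fin n) (Fin n) ℝ}
    {m : Fin n} (hA : ∀ l ≠ m, IsClosedField (A l)) {φ u : V n → ℝ}
    (hφ : ContDiff ℝ ∞ φ) (hc : HasCompactSupport φ) (hu : ContDiff ℝ ∞ u) :
    ∫ x, φ x * mixedDisc n (Function.update (fun l => A l x) m (hess u x)) =
      ∫ x, u x * mixedDisc n (Function.update (fun l => A l x) m (hess φ x)) := by
  have hdφ := differentiable_of_smooth hφ
  have hdu := differentiable_of_smooth hu
  have hr := integral_mixedDisc_update_pderiv_row hA (w := fun j x => φ x * pderiv j u x)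
    (fun j => hφ.mul (contDiff_pderiv hu j)) fun j => hc.mul_right
  have hcol := integral_mixedDisc_update_pderiv_col hA (w := fun i x => u x * pderiv i φ x)
    (fun i => hu.mul (contDiff_pderiv hφ i)) fun i => (hc.pderiv i).mul_left
  have hint : ∀ {H : V n → Matrix (Fin n) (Fin n) ℝ}, (∀ i j, Continuous fun x => H x i j) →
      (∀ x ∉ tsupport φ, H x = 0) →
      Integrable fun x => mixedDisc n (Function.update (fun l => A l x) m (H x)) := by
    intro H hH h0
    refine (continuous_mixedDisc_update hA hH).integrable_of_hasCompactSupport ?_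
    refine HasCompactSupport.intro hc fun x hx => ?_
    rw [h0 x hx, MultilinearMap.map_update_zero]
  have hcont : ∀ {g : V n → ℝ}, ContDiff ℝ ∞ g → ∀ i, Continuous (pderiv i g) := fun hg i =>
    (contDiff_pderiv hg i).continuous
  have h1 := hint (H := fun x => φ x • hess u x)
    (fun i j => hφ.continuous.mul (continuous_hess hu i j))
    (fun x hx => by simp [image_eq_zero_of_notMem_tsupport hx])
  have h2 := hint (H := fun x => u x • hess φ x)
    (fun i j => hu.continuous.mul (continuous_hess hφ i j))
    (fun x hx => by simp [hess_eq_zero_of_notMem hx])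
  have h3 := hint (H := fun x => Matrix.of fun i j => pderiv i (fun x => φ x * pderiv j u x) x)
    (fun i j => hcont (hφ.mul (contDiff_pderiv hu j)) i)
    (fun x hx => by
      ext i j
      exact image_eq_zero_of_notMem_tsupport (f := pderiv i fun x => φ x * pderiv j u x) fun h =>
        hx (tsupport_mul_subset_left (tsupport_pderiv_subset _ i h)))
  have h4 := hint (H := fun x => Matrix.of fun i j => pderiv j (fun x => u x * pderiv i φ x) x)
    (fun i j => hcont (hu.mul (contDiff_pderiv hφ i)) j)
    (fun x hx => by
      ext i j
      exact image_eq_zero_of_notMem_tsupport (f := pderiv j fun x => u x * pderiv i φ x) fun h =>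
        hx (tsupport_pderiv_subset _ i (tsupport_mul_subset_right (tsupport_pderiv_subset _ j h))))
  simp only [MultilinearMap.map_update_smul, smul_eq_mul] at h1 h2
  rw [← sub_eq_zero, ← integral_sub h1 h2]
  -- In terms of matrices, `φ ∂_i∂_j u - u ∂_i∂_j φ = ∂_i(φ ∂_j u) - ∂_j(u ∂_i φ)`, where the two
  -- terms `∂_i φ ∂_j u` cancel.
  have h5 : ∀ x, φ x * mixedDisc n (Function.update (fun l => A l x) m (hess u x)) -
      u x * mixedDisc n (Function.update (fun l => A l x) m (hess φ x)) =
      mixedDisc n (Function.update (fun l => A l x) m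
        (Matrix.of fun i j => pderiv i (fun x => φ x * pderiv j u x) x)) -
      mixedDisc n (Function.update (fun l => A l x) m
        (Matrix.of fun i j => pderiv j (fun x => u x * pderiv i φ x) x)) := by
    intro x
    rw [← smul_eq_mul, ← MultilinearMap.map_update_smul, ← smul_eq_mul,
      ← MultilinearMap.map_update_smul, ← MultilinearMap.map_update_sub,
      ← MultilinearMap.map_update_sub]
    congr 2
    ext i j
    simp only [Matrix.sub_apply, Matrix.smul_apply, Matrix.of_apply, smul_eq_mul, hess]
    rw [pderiv_mul hdφ (differentiable_of_smooth (contDiff_pderiv hu j)),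
      pderiv_mul hdu (differentiable_of_smooth (contDiff_pderiv hφ i)), pderiv_comm hφ i j]
    ring
  simp_rw [h5]
  rw [integral_sub h3 h4, hr, hcol, sub_zero]

/-! ### Mass estimates -/

/-- The matrices at `x` of the forms `dd^# g_l` in the slots `l ∈ s`, and the constant matrices
`B_l` in the others. -/
noncomputable def mixField (s : Finset (Fin n)) (g : Fin n → V n → ℝ)
    (B : Fin n → Matrix (Fin n) (Fin n) ℝ) (x : V n) : Fin n → Matrix (Fin n) (Fin n) ℝ :=
  s.piecewise (fun l => hess (g l) x) B

/-- A family `χ_0, χ_1, …` of cutoff functions with supports in `U`, in which the entries of the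
Hessian of each of `χ_1, …, χ_N` are at most `c` times the function before it. -/
structure IsCutoffFamily (N : ℕ) (χ : ℕ → V n → ℝ) (c : ℝ) (U : Set (V n)) : Prop where
  contDiff : ∀ j, ContDiff ℝ ∞ (χ j)
  hasCompactSupport : ∀ j, HasCompactSupport (χ j)
  nonneg : ∀ j x, 0 ≤ χ j x
  const_nonneg : 0 ≤ c
  mem_of_ne_zero : ∀ j x, χ j x ≠ 0 → x ∈ U
  abs_hess_le : ∀ j < N, ∀ x i k, |hess (χ (j + 1)) x i k| ≤ c * χ j x

theorem isClosedField_mixField (s : Finset (Fin n)) {g : Fin n → V n → ℝ}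
    (hg : ∀ l, ContDiff ℝ ∞ (g l)) (B : Fin n → Matrix (Fin n) (Fin n) ℝ) (l : Fin n) :
    IsClosedField fun x => mixField s g B x l := by
  by_cases h : l ∈ s
  · simpa [mixField, h] using! isClosedField_hess (hg l)
  · simpa [mixField, h] using isClosedField_const (B l)

theorem continuous_mixedDisc_mixField (s : Finset (Fin n)) {g : Fin n → V n → ℝ}
    (hg : ∀ l, ContDiff ℝ ∞ (g l)) (B : Fin n → Matrix (Fin n) (Fin n) ℝ) :
    Continuous fun x => mixedDisc n (mixField s g B x) :=
  continuous_mixedDisc (A := fun l x => mixField s g B x l) fun l i j =>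
    ((isClosedField_mixField s hg B l).contDiff i j).continuous

theorem mixField_insert (s : Finset (Fin n)) (m : Fin n) (g : Fin n → V n → ℝ)
    (B : Fin n → Matrix (Fin n) (Fin n) ℝ) (x : V n) :
    mixField (insert m s) g B x = Function.update (mixField s g B x) m (hess (g m) x) := by
  rw [mixField, Finset.piecewise_insert, mixField]

theorem mixedDisc_mixField_one_nonneg (s : Finset (Fin n)) {g : Fin n → V n → ℝ}
    (hg : ∀ l, ContDiff ℝ ∞ (g l)) (hconv : ∀ l, ConvexOn ℝ univ (g l)) (x : V n) :
    0 ≤ mixedDisc n (mixField s g 1 x) := by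
  refine mixedDisc_nonneg fun l => ?_
  by_cases h : l ∈ s
  · simpa [mixField, h] using posSemidef_hess (hg l) (hconv l) x
  · simpa [mixField, h] using Matrix.PosSemidef.one

theorem integrable_mul_mixedDisc {φ : V n → ℝ} (hφ : Continuous φ) (hc : HasCompactSupport φ)
    (s : Finset (Fin n)) {g : Fin n → V n → ℝ} (hg : ∀ l, ContDiff ℝ ∞ (g l))
    (B : Fin n → Matrix (Fin n) (Fin n) ℝ) :
    Integrable fun x => φ x * mixedDisc n (mixField s g B x) :=
  (hφ.mul (continuous_mixedDisc_mixField s hg B)).integrable_of_hasCompactSupport hc.mul_right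

/-- One step of the mass estimate: a factor `dd^# u` is integrated by parts onto the test function,
and replaced by the identity matrix. -/
theorem abs_integral_mul_mixedDisc_update_le {s : Finset (Fin n)} {m : Fin n} (hm : m ∉ s)
    {g : Fin n → V n → ℝ} (hg : ∀ l, ContDiff ℝ ∞ (g l)) (hconv : ∀ l, ConvexOn ℝ univ (g l))
    {B : Fin n → Matrix (Fin n) (Fin n) ℝ} (hB : ∀ l ∉ s, l ≠ m → IsContraction (B l))
    {φ χ u : V n → ℝ} (hφ : ContDiff ℝ ∞ φ) (hφc : HasCompactSupport φ)
    (hχ : Continuous χ) (hχc : HasCompactSupport χ) (hχ0 : ∀ x, 0 ≤ χ x)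
    (hu : ContDiff ℝ ∞ u) {c M : ℝ} (hc : 0 ≤ c)
    (hφχ : ∀ x i k, |hess φ x i k| ≤ c * χ x) (huM : ∀ x, χ x ≠ 0 → |u x| ≤ M) :
    |∫ x, φ x * mixedDisc n (Function.update (mixField s g B x) m (hess u x))| ≤
      n * c * M * ∫ x, χ x * mixedDisc n (mixField s g 1 x) := by
  have h1 := integral_mul_mixedDisc_hess (A := fun l x => mixField s g B x l) (m := m)
    (fun l _ => isClosedField_mixField s hg B l) hφ hφc hu
  rw [h1, ← integral_const_mul]
  refine abs_integral_le_integral_abs.trans ?_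
  refine integral_mono_of_nonneg (Eventually.of_forall fun x => abs_nonneg _)
    ((integrable_mul_mixedDisc hχ hχc s hg 1).const_mul _) (Eventually.of_forall fun x => ?_)
  have hA : ∀ l ∈ s, (hess (g l) x).PosSemidef := fun l _ => posSemidef_hess (hg l) (hconv l) x
  have h2 := abs_mixedDisc_update_piecewise_le s hm hA hB (mul_nonneg hc (hχ0 x)) (hφχ x)
  have hD := mixedDisc_mixField_one_nonneg s hg hconv x
  change |u x * mixedDisc n (Function.update (mixField s g B x) m (hess φ x))| ≤
    n * c * M * (χ x * mixedDisc n (mixField s g 1 x))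
  change |mixedDisc n (Function.update (mixField s g B x) m (hess φ x))| ≤
    n * (c * χ x) * mixedDisc n (mixField s g 1 x) at h2
  rw [abs_mul]
  by_cases hx : χ x = 0
  · rw [hx] at h2 ⊢
    simp only [mul_zero, zero_mul] at h2 ⊢
    rw [le_antisymm h2 (abs_nonneg _), mul_zero]
  · calc |u x| * |mixedDisc n (Function.update (mixField s g B x) m (hess φ x))|
        ≤ M * (n * (c * χ x) * mixedDisc n (mixField s g 1 x)) :=
          mul_le_mul (huM x hx) h2 (abs_nonneg _) ((abs_nonneg _).trans (huM x hx))
      _ = _ := by ring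

/-- Chern–Levine–Nirenberg inequality: the mass of `dd^# g_1 ∧ … ∧ dd^# g_p` on compact sets is
controlled by the suprema of the convex functions. -/
theorem integral_cutoff_mul_mixedDisc_le {N : ℕ} {χ : ℕ → V n → ℝ} {c : ℝ} {U : Set (V n)}
    (hχ : IsCutoffFamily N χ c U) {g : Fin n → V n → ℝ} (hg : ∀ l, ContDiff ℝ ∞ (g l))
    (hconv : ∀ l, ConvexOn ℝ univ (g l)) {M : ℝ} (hM : 0 ≤ M) (s : Finset (Fin n))
    (hs : s.card ≤ N) (hgM : ∀ l ∈ s, ∀ x ∈ U, |g l x| ≤ M) :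
    ∫ x, χ s.card x * mixedDisc n (mixField s g 1 x) ≤
      (n * c * M) ^ s.card * (mixedDisc n 1 * ∫ x, χ 0 x) := by
  induction s using Finset.induction_on with
  | empty => simp [mixField, integral_mul_const, mul_comm]
  | insert m s hm ih =>
    rw [Finset.card_insert_of_notMem hm] at hs ⊢
    have ih := ih (by omega) fun l hl => hgM l (Finset.mem_insert_of_mem hl)
    simp_rw [mixField_insert]
    have h := abs_integral_mul_mixedDisc_update_le hm hg hconv (B := 1)
      (fun _ _ _ => isContraction_one) (hχ.contDiff (s.card + 1)) (hχ.hasCompactSupport _)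
      (hχ.contDiff s.card).continuous (hχ.hasCompactSupport _) (hχ.nonneg _) (hg m)
      hχ.const_nonneg (hχ.abs_hess_le s.card (by omega))
      fun x hx => hgM m (Finset.mem_insert_self m s) x (hχ.mem_of_ne_zero _ x hx)
    refine (le_abs_self _).trans (h.trans ?_)
    have hc := hχ.const_nonneg
    calc n * c * M * ∫ x, χ s.card x * mixedDisc n (mixField s g 1 x)
        ≤ n * c * M * ((n * c * M) ^ s.card * (mixedDisc n 1 * ∫ x, χ 0 x)) := by gcongr
      _ = _ := by ring

/-- The pairing with a test function is bounded by the sup norm of the test function. -/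
theorem abs_integral_mul_mixedDisc_le {N : ℕ} {χ : ℕ → V n → ℝ} {c : ℝ} {U : Set (V n)}
    (hχ : IsCutoffFamily N χ c U) {g : Fin n → V n → ℝ} (hg : ∀ l, ContDiff ℝ ∞ (g l))
    (hconv : ∀ l, ConvexOn ℝ univ (g l)) {M : ℝ} (hM : 0 ≤ M) {s : Finset (Fin n)}
    (hs : s.card ≤ N) (hgM : ∀ l ∈ s, ∀ x ∈ U, |g l x| ≤ M)
    {B : Fin n → Matrix (Fin n) (Fin n) ℝ} (hB : ∀ l ∉ s, IsContraction (B l))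
    {φ : V n → ℝ} {a : ℝ} (ha : 0 ≤ a) (hφ : ∀ x, |φ x| ≤ a * χ s.card x) :
    |∫ x, φ x * mixedDisc n (mixField s g B x)| ≤
      a * ((n * c * M) ^ s.card * (mixedDisc n 1 * ∫ x, χ 0 x)) := by
  refine le_trans ?_ (mul_le_mul_of_nonneg_left
    (integral_cutoff_mul_mixedDisc_le hχ hg hconv hM s hs hgM) ha)
  rw [← integral_const_mul]
  refine abs_integral_le_integral_abs.trans ?_
  refine integral_mono_of_nonneg (Eventually.of_forall fun x => abs_nonneg _)
    ((integrable_mul_mixedDisc (hχ.contDiff _).continuous (hχ.hasCompactSupport _) s hg 1).const_mul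
      _) (Eventually.of_forall fun x => ?_)
  have h := abs_mixedDisc_piecewise_le s (fun l _ => posSemidef_hess (hg l) (hconv l) x) hB
  change |φ x * mixedDisc n (mixField s g B x)| ≤
    a * (χ s.card x * mixedDisc n (mixField s g 1 x))
  rw [abs_mul, ← mul_assoc]
  exact mul_le_mul (hφ x) h (abs_nonneg _) ((abs_nonneg _).trans (hφ x))

/-- Two families of convex functions which are uniformly close near the support of the test function
have close pairings: they are exchanged one at a time, each time integrating the difference by
parts. -/
theorem abs_integral_sub_integral_mixedDisc_le {N : ℕ} {χ : ℕ → V n → ℝ} {c : ℝ} {U : Set (V n)}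
    (hχ : IsCutoffFamily N χ c U) {g h : Fin n → V n → ℝ} (hg : ∀ l, ContDiff ℝ ∞ (g l))
    (hgconv : ∀ l, ConvexOn ℝ univ (g l)) (hh : ∀ l, ContDiff ℝ ∞ (h l))
    (hhconv : ∀ l, ConvexOn ℝ univ (h l)) {M η : ℝ} (hM : 0 ≤ M) (hη : 0 ≤ η)
    {s : Finset (Fin n)} (hs : s.card ≤ N) (hgM : ∀ l ∈ s, ∀ x ∈ U, |g l x| ≤ M)
    (hhM : ∀ l ∈ s, ∀ x ∈ U, |h l x| ≤ M) (hgh : ∀ l ∈ s, ∀ x ∈ U, |g l x - h l x| ≤ η)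
    {B : Fin n → Matrix (Fin n) (Fin n) ℝ} (hB : ∀ l ∉ s, IsContraction (B l))
    {φ : V n → ℝ} (hφ : ContDiff ℝ ∞ φ) (hφc : HasCompactSupport φ)
    (hφχ : ∀ j x i k, |hess φ x i k| ≤ c * χ j x) :
    |(∫ x, φ x * mixedDisc n (mixField s g B x)) -
      ∫ x, φ x * mixedDisc n (mixField s h B x)| ≤
      s.card * (n * c * η * ((n * c * M) ^ (s.card - 1) * (mixedDisc n 1 * ∫ x, χ 0 x))) := by
  set K := n * c * η * ((n * c * M) ^ (s.card - 1) * (mixedDisc n 1 * ∫ x, χ 0 x)) with hK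
  have hc := hχ.const_nonneg
  suffices H : ∀ t ⊆ s, |(∫ x, φ x * mixedDisc n (mixField s g B x)) -
      ∫ x, φ x * mixedDisc n (mixField s (t.piecewise h g) B x)| ≤ t.card * K by
    have := H s Subset.rfl
    have h1 : ∀ x, mixField s (s.piecewise h g) B x = mixField s h B x := fun x => by
      funext l
      by_cases hl : l ∈ s <;> simp [mixField, hl]
    simpa only [h1] using this
  intro t
  induction t using Finset.induction_on with
  | empty => simp
  | insert m t hm ih =>
    intro hts
    have ih := ih ((Finset.subset_insert m t).trans hts)
    have hms : m ∈ s := hts (Finset.mem_insert_self m t)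
    have hms' : m ∉ s.erase m := Finset.notMem_erase m s
    set k := t.piecewise h g with hk
    have hksm : ∀ l, ContDiff ℝ ∞ (k l) := fun l => by
      by_cases hl : l ∈ t <;> simp [hk, hl, hg, hh]
    have hkconv : ∀ l, ConvexOn ℝ univ (k l) := fun l => by
      by_cases hl : l ∈ t <;> simp [hk, hl, hgconv, hhconv]
    have hkM : ∀ l ∈ s.erase m, ∀ x ∈ U, |k l x| ≤ M := fun l hl x hx => by
      have hl' := Finset.mem_of_mem_erase hl
      by_cases hl : l ∈ t
      · simpa [hk, hl] using hhM l hl' x hx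
      · simpa [hk, hl] using hgM l hl' x hx
    have h1 : ∀ x, mixField s k B x =
        Function.update (mixField (s.erase m) k B x) m (hess (g m) x) := fun x => by
      conv_lhs => rw [← Finset.insert_erase hms]
      rw [mixField_insert]
      simp [hk, hm]
    have h2 : ∀ x, mixField s ((insert m t).piecewise h g) B x =
        Function.update (mixField (s.erase m) k B x) m (hess (h m) x) := fun x => by
      conv_lhs => rw [← Finset.insert_erase hms]
      rw [mixField_insert]
      funext l
      by_cases hlm : l = m
      · subst hlm; simp
      · by_cases hl : l ∈ s <;> by_cases hlt : l ∈ t <;> simp [mixField, hk, hlm, hl, hlt]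
    have h3 : |(∫ x, φ x * mixedDisc n (mixField s k B x)) -
        ∫ x, φ x * mixedDisc n (mixField s ((insert m t).piecewise h g) B x)| ≤ K := by
      have hk2 : ∀ l, ContDiff ℝ ∞ ((insert m t).piecewise h g l) := fun l => by
        by_cases hl : l ∈ insert m t <;> simp only [Finset.piecewise, hl, if_true, if_false, hg, hh]
      rw [← integral_sub (integrable_mul_mixedDisc hφ.continuous hφc s hksm B)
        (integrable_mul_mixedDisc hφ.continuous hφc s hk2 B)]
      simp_rw [h1, h2, ← mul_sub, ← MultilinearMap.map_update_sub,
        ← hess_sub (hg m) (hh m)]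
      have hB' : ∀ l ∉ s.erase m, l ≠ m → IsContraction (B l) := fun l hl hlm =>
        hB l fun h => hl (Finset.mem_erase.2 ⟨hlm, h⟩)
      refine (abs_integral_mul_mixedDisc_update_le hms' hksm hkconv hB' hφ hφc
        (hχ.contDiff _).continuous (hχ.hasCompactSupport _) (hχ.nonneg _)
        ((hg m).sub (hh m)) hc (hφχ (s.erase m).card)
        fun x hx => hgh m hms x (hχ.mem_of_ne_zero _ x hx)).trans ?_
      rw [hK]
      have := integral_cutoff_mul_mixedDisc_le hχ hksm hkconv hM (s.erase m)
        ((Finset.card_erase_le).trans hs) hkM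
      rw [Finset.card_erase_of_mem hms] at this ⊢
      gcongr
    rw [Finset.card_insert_of_notMem hm]
    calc _ ≤ |(∫ x, φ x * mixedDisc n (mixField s g B x)) -
          ∫ x, φ x * mixedDisc n (mixField s k B x)| +
          |(∫ x, φ x * mixedDisc n (mixField s k B x)) -
          ∫ x, φ x * mixedDisc n (mixField s ((insert m t).piecewise h g) B x)| :=
          abs_sub_le _ _ _
      _ ≤ t.card * K + K := add_le_add ih h3
      _ = _ := by push_cast; ring

theorem exists_abs_hess_le {φ : V n → ℝ} (hφ : ContDiff ℝ ∞ φ) (hc : HasCompactSupport φ) :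
    ∃ C, 0 ≤ C ∧ ∀ x i k, |hess φ x i k| ≤ C := by
  have h : ∀ i k, ∃ C, ∀ x, |hess φ x i k| ≤ C := fun i k =>
    (continuous_hess hφ i k).bounded_above_of_compact_support ((hc.pderiv k).pderiv i)
  choose C hC using h
  have hC0 : ∀ i k, 0 ≤ C i k := fun i k => (abs_nonneg _).trans (hC i k 0)
  refine ⟨∑ i, ∑ k, C i k, Finset.sum_nonneg fun i _ => Finset.sum_nonneg fun k _ => hC0 i k,
    fun x i k => (hC i k x).trans ?_⟩
  exact (Finset.single_le_sum (fun k _ => hC0 i k) (Finset.mem_univ k)).trans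
    (Finset.single_le_sum (f := fun i => ∑ k, C i k)
      (fun i _ => Finset.sum_nonneg fun k _ => hC0 i k) (Finset.mem_univ i))

/-- Bump functions on shrinking balls, each equal to `1` on the support of the one after it. -/
theorem exists_isCutoffFamily (N : ℕ) (x₀ : V n) {r R : ℝ} (hr : 0 < r) (hrR : r < R) :
    ∃ (χ : ℕ → V n → ℝ) (c : ℝ), IsCutoffFamily N χ c (Metric.ball x₀ R) ∧
      ∀ j, ∀ x ∈ Metric.closedBall x₀ r, χ j x = 1 := by
  let ρ : ℕ → ℝ := fun k => r + (R - r) / (k + 1)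
  have hρr : ∀ k, r < ρ k := fun k => by
    have : 0 < (R - r) / ((k : ℝ) + 1) := div_pos (sub_pos.2 hrR) (by positivity)
    simp only [ρ]; linarith
  have hρ : ∀ k, ρ (k + 1) < ρ k := fun k => by
    simp only [ρ]
    have := sub_pos.2 hrR
    push_cast
    gcongr
    linarith
  have hρ0 : ρ 0 = R := by simp [ρ]
  have hρR : ∀ k, ρ k ≤ R := fun k => by
    rw [← hρ0]
    exact (antitone_nat_of_succ_le fun k => (hρ k).le) (Nat.zero_le k)
  let b : ℕ → ContDiffBump x₀ := fun j =>
    ⟨ρ (2 * j + 1), ρ (2 * j), hr.trans (hρr _), hρ _⟩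
  have hsm : ∀ j, ContDiff ℝ ∞ (b j) := fun j => (b j).contDiff
  have hcs : ∀ j, HasCompactSupport (b j) := fun j => (b j).hasCompactSupport
  choose C hC0 hC using fun j => exists_abs_hess_le (hsm j) (hcs j)
  refine ⟨fun j => b j, ∑ j ∈ Finset.range N, C (j + 1),
    ⟨hsm, hcs, fun j x => (b j).nonneg, Finset.sum_nonneg fun j _ => hC0 _, fun j x hx => ?_,
      fun j hj x i k => ?_⟩, fun j x hx => (b j).one_of_mem_closedBall
        (Metric.closedBall_subset_closedBall (hρr _).le hx)⟩
  · have : x ∈ Function.support (b j) := hx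
    rw [(b j).support_eq] at this
    exact Metric.ball_subset_ball (hρR _) this
  · by_cases hx : x ∈ tsupport (b (j + 1))
    · rw [(b (j + 1)).tsupport_eq] at hx
      have h1 : b j x = 1 := (b j).one_of_mem_closedBall
        (Metric.closedBall_subset_closedBall (hρ (2 * j + 1)).le hx)
      rw [h1, mul_one]
      exact (hC (j + 1) x i k).trans
        (Finset.single_le_sum (f := fun j => C (j + 1)) (fun j _ => hC0 _) (Finset.mem_range.2 hj))
    · rw [hess_eq_zero_of_notMem hx]
      simpa using mul_nonneg (Finset.sum_nonneg fun j _ => hC0 _) (b j).nonneg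

theorem IsCutoffFamily.mono_const {N : ℕ} {χ : ℕ → V n → ℝ} {c c' : ℝ} {U : Set (V n)}
    (h : IsCutoffFamily N χ c U) (hc : c ≤ c') : IsCutoffFamily N χ c' U :=
  { h with
    const_nonneg := h.const_nonneg.trans hc
    abs_hess_le := fun j hj x i k => (h.abs_hess_le j hj x i k).trans
      (mul_le_mul_of_nonneg_right hc (h.nonneg j x)) }

variable {p : ℕ}

/-! ### The pairing as a sum of integrals of mixed discriminants -/

/-- The first `p` of the `n` slots. -/
def firstSlots (n p : ℕ) : Finset (Fin n) := Finset.univ.filter fun l => (l : ℕ) < p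

theorem card_firstSlots (hp : p ≤ n) : (firstSlots n p).card = p := by
  rw [firstSlots, Fin.card_filter_val_lt, min_eq_right hp]

/-- The matrices of `dd^# g_1 ∧ … ∧ dd^# g_p ∧ dx_K ∧ dξ_L` at `x`; the functions
in the last `n - p` slots, and the constant matrices in the first `p`, are irrelevant. -/
noncomputable def formField (hp : p ≤ n) (g : Fin p → V n → ℝ) (K L : MultiIndex n (n - p))
    (x : V n) : Fin n → Matrix (Fin n) (Fin n) ℝ :=
  mixField (firstSlots n p) (slots hp g fun _ => 0) (slots hp (fun _ => 0) (elemSlots K L)) x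

theorem formField_eq (hp : p ≤ n) (g : Fin p → V n → ℝ) (K L : MultiIndex n (n - p)) (x : V n) :
    formField hp g K L x = slots hp (fun i => hess (g i) x) (elemSlots K L) := by
  funext l
  by_cases hl : (l : ℕ) < p
  · simp [formField, mixField, firstSlots, Finset.piecewise, hl, slots_of_lt]
  · simp [formField, mixField, firstSlots, Finset.piecewise, hl, slots_of_not_lt]

theorem slots_zero_induction {P : (V n → ℝ) → Prop} (hp : p ≤ n) {g : Fin p → V n → ℝ}
    (hg : ∀ i, P (g i)) (h0 : P 0) (l : Fin n) : P (slots hp g (fun _ => 0) l) := by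
  by_cases hl : (l : ℕ) < p
  · rw [slots_of_lt hp _ _ hl]; exact hg _
  · rw [slots_of_not_lt hp _ _ hl]; exact h0

theorem contDiff_slots (hp : p ≤ n) {g : Fin p → V n → ℝ} (hg : ∀ i, ContDiff ℝ ∞ (g i))
    (l : Fin n) : ContDiff ℝ ∞ (slots hp g (fun _ => 0) l) :=
  slots_zero_induction hp hg contDiff_const l

theorem convexOn_slots (hp : p ≤ n) {g : Fin p → V n → ℝ} (hg : ∀ i, ConvexOn ℝ univ (g i))
    (l : Fin n) : ConvexOn ℝ univ (slots hp g (fun _ => 0) l) :=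
  slots_zero_induction hp hg (convexOn_const 0 convex_univ) l

theorem isContraction_slots (hp : p ≤ n) (K L : MultiIndex n (n - p)) :
    ∀ l ∉ firstSlots n p, IsContraction (slots hp (fun _ => 0) (elemSlots K L) l) := by
  intro l hl
  rw [slots_of_not_lt hp _ _ (by simpa [firstSlots] using hl)]
  exact isContraction_elemSlots K L _

theorem TestForm.contDiff_coeff {q : ℕ} (α : TestForm n q) (K L : MultiIndex n q) :
    ContDiff ℝ ∞ fun x => α x K L :=
  contDiff_pi.1 (contDiff_pi.1 (TestFunction.contDiff α) K) L

theorem TestForm.tsupport_coeff_subset {q : ℕ} (α : TestForm n q) (K L : MultiIndex n q) :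
    (tsupport fun x => α x K L) ⊆ tsupport α :=
  closure_mono fun x hx h => hx (by simp [h])

theorem TestForm.hasCompactSupport_coeff {q : ℕ} (α : TestForm n q) (K L : MultiIndex n q) :
    HasCompactSupport fun x => α x K L :=
  (TestFunction.hasCompactSupport α).of_isClosed_subset (isClosed_tsupport _)
    (α.tsupport_coeff_subset K L)

theorem TestForm.abs_coeff_le {q : ℕ} (α : TestForm n q) (K L : MultiIndex n q) (x : V n) :
    |α x K L| ≤ ‖α x‖ :=
  (norm_le_pi_norm (α x K) L).trans (norm_le_pi_norm (α x) K)

theorem integrable_coeff_mul (hp : p ≤ n) {g : Fin p → V n → ℝ} (hg : ∀ i, ContDiff ℝ ∞ (g i))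
    (α : TestForm n (n - p)) (K L : MultiIndex n (n - p)) :
    Integrable fun x => α x K L * mixedDisc n (formField hp g K L x) :=
  integrable_mul_mixedDisc (α.contDiff_coeff K L).continuous (α.hasCompactSupport_coeff K L) _
    (contDiff_slots hp hg) _

/-- The constants `c K L` are the signs of the reorderings of `dx_K ∧ dξ_L`. -/
theorem exists_smoothPairing_eq (hp : p ≤ n) :
    ∃ c : MultiIndex n (n - p) → MultiIndex n (n - p) → ℝ, ∀ g : Fin p → V n → ℝ,
      (∀ i, ContDiff ℝ ∞ (g i)) → ∀ α : TestForm n (n - p), smoothPairing g α =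
        ∑ K, ∑ L, c K L * ∫ x, α x K L * mixedDisc n (formField hp g K L x) := by
  choose c hc using fun K L => exists_topCoeff_mul hp (n := n) K L
  refine ⟨c, fun g hg α => ?_⟩
  have h : ∀ x, topCoeff n (ddSharpProd g x * TestForm.value α x) =
      ∑ K, ∑ L, c K L * (α x K L * mixedDisc n (formField hp g K L x)) := by
    intro x
    simp only [TestForm.value, Finset.mul_sum, map_sum, mul_smul_comm, map_smul, smul_eq_mul]
    refine Finset.sum_congr rfl fun K _ => Finset.sum_congr rfl fun L _ => ?_
    rw [formField_eq, mul_left_comm, ← hc]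
    simp only [ddSharpProd, ddSharp_eq]
  have hint := integrable_coeff_mul hp hg α
  simp only [smoothPairing, h]
  rw [integral_finsetSum _ fun K _ => integrable_finsetSum _ fun L _ => (hint K L).const_mul _]
  refine Finset.sum_congr rfl fun K _ => ?_
  rw [integral_finsetSum _ fun L _ => (hint K L).const_mul _]
  exact Finset.sum_congr rfl fun L _ => integral_const_mul _ _

theorem smoothPairing_congr_hess (hp : p ≤ n) {g h : Fin p → V n → ℝ}
    (hg : ∀ i, ContDiff ℝ ∞ (g i)) (hh : ∀ i, ContDiff ℝ ∞ (h i))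
    (hgh : ∀ i x, hess (g i) x = hess (h i) x) (α : TestForm n (n - p)) :
    smoothPairing g α = smoothPairing h α := by
  obtain ⟨c, hc⟩ := exists_smoothPairing_eq (n := n) hp
  simp only [hc g hg, hc h hh, formField_eq, hgh]

theorem exists_smoothPairing_linear (hp : p ≤ n) {g : Fin p → V n → ℝ}
    (hg : ∀ i, ContDiff ℝ ∞ (g i)) :
    ∃ S : TestForm n (n - p) →ₗ[ℝ] ℝ, ∀ α, S α = smoothPairing g α := by
  obtain ⟨c, hc⟩ := exists_smoothPairing_eq (n := n) hp
  refine ⟨⟨⟨smoothPairing g, fun α β => ?_⟩, fun a α => ?_⟩, fun α => rfl⟩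
  · simp only [hc g hg, ← Finset.sum_add_distrib, ← mul_add]
    refine Finset.sum_congr rfl fun K _ => Finset.sum_congr rfl fun L _ => ?_
    rw [← integral_add (integrable_coeff_mul hp hg α K L) (integrable_coeff_mul hp hg β K L)]
    simp [add_mul]
  · simp only [hc g hg, Finset.mul_sum, RingHom.id_apply, smul_eq_mul]
    refine Finset.sum_congr rfl fun K _ => Finset.sum_congr rfl fun L _ => ?_
    rw [mul_left_comm, ← integral_const_mul a]
    simp only [smul_apply, Pi.smul_apply, smul_eq_mul, mul_assoc]

/-- The pairing is of order zero, uniformly for convex functions which are bounded on the supports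
of the cutoff functions. -/
theorem exists_abs_smoothPairing_le (n : ℕ) (hp : p ≤ n) :
    ∃ C, 0 ≤ C ∧ ∀ {N : ℕ} {χ : ℕ → V n → ℝ} {c : ℝ} {U : Set (V n)}, IsCutoffFamily N χ c U →
      p ≤ N → ∀ g : Fin p → V n → ℝ, (∀ i, ContDiff ℝ ∞ (g i)) → (∀ i, ConvexOn ℝ univ (g i)) →
      ∀ M, 0 ≤ M → (∀ i, ∀ x ∈ U, |g i x| ≤ M) → ∀ α : TestForm n (n - p), ∀ a, 0 ≤ a →
      (∀ x, ‖α x‖ ≤ a * χ p x) →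
      |smoothPairing g α| ≤ C * (a * ((c * M) ^ p * ∫ x, χ 0 x)) := by
  obtain ⟨k, hk⟩ := exists_smoothPairing_eq (n := n) hp
  have h1 : 0 ≤ mixedDisc n 1 := mixedDisc_nonneg fun _ => Matrix.PosSemidef.one
  refine ⟨∑ K, ∑ L, |k K L| * (n ^ p * mixedDisc n 1), by positivity, ?_⟩
  intro N χ c U hχ hpN g hg hconv M hM hgM α a ha hα
  rw [hk g hg, Finset.sum_mul]
  refine (Finset.abs_sum_le_sum_abs _ _).trans (Finset.sum_le_sum fun K _ => ?_)
  rw [Finset.sum_mul]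
  refine (Finset.abs_sum_le_sum_abs _ _).trans (Finset.sum_le_sum fun L _ => ?_)
  rw [abs_mul]
  have h := abs_integral_mul_mixedDisc_le hχ (contDiff_slots hp hg) (convexOn_slots hp hconv) hM
    (s := firstSlots n p) (by rwa [card_firstSlots hp])
    (fun l hl x hx => slots_zero_induction (P := fun u => |u x| ≤ M) hp
      (fun i => hgM i x hx) (by simpa using hM) l)
    (isContraction_slots hp K L) (φ := fun x => α x K L) ha
    (fun x => (α.abs_coeff_le K L x).trans (by simpa [card_firstSlots hp] using hα x))
  rw [card_firstSlots hp] at h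
  calc |k K L| * |∫ x, α x K L * mixedDisc n (formField hp g K L x)|
      ≤ |k K L| * (a * ((n * c * M) ^ p * (mixedDisc n 1 * ∫ x, χ 0 x))) := by
        gcongr; exact h
    _ = _ := by ring

theorem tendsto_zero_of_abs_le {ι : Type*} {l : Filter ι} {u : ι → ℝ} {C : ℝ}
    (h : ∀ η > 0, η ≤ 1 → ∀ᶠ k in l, |u k| ≤ C * η) : Tendsto u l (𝓝 0) := by
  rw [Metric.tendsto_nhds]
  intro ε hε
  have hC : 0 < |C| + 1 := by positivity
  filter_upwards [h (min 1 (ε / (2 * (|C| + 1)))) (by positivity) (min_le_left _ _)] with k hk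
  rw [Real.dist_eq, sub_zero]
  calc |u k| ≤ C * min 1 (ε / (2 * (|C| + 1))) := hk
    _ ≤ (|C| + 1) * (ε / (2 * (|C| + 1))) := by
        gcongr
        · linarith [le_abs_self C]
        · exact min_le_right _ _
    _ = ε / 2 := by field_simp
    _ < ε := by linarith

/-- Two sequences of smooth convex functions with the same uniform limit on a ball have the same
limit pairings with the test forms supported in a smaller ball. -/
theorem tendsto_smoothPairing_sub (hp : p ≤ n) {ι : Type*} {l : Filter ι}
    {g h : ι → Fin p → V n → ℝ} (hg : ∀ k i, ContDiff ℝ ∞ (g k i))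
    (hgc : ∀ k i, ConvexOn ℝ univ (g k i)) (hh : ∀ k i, ContDiff ℝ ∞ (h k i))
    (hhc : ∀ k i, ConvexOn ℝ univ (h k i)) {f : Fin p → V n → ℝ} {x₀ : V n} {r R : ℝ}
    (hr : 0 < r) (hrR : r < R)
    (hgf : ∀ i, TendstoUniformlyOn (fun k => g k i) (f i) l (Metric.ball x₀ R))
    (hhf : ∀ i, TendstoUniformlyOn (fun k => h k i) (f i) l (Metric.ball x₀ R))
    {M : ℝ} (hM : ∀ i, ∀ x ∈ Metric.ball x₀ R, |f i x| ≤ M) {α : TestForm n (n - p)}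
    (hα : tsupport α ⊆ Metric.closedBall x₀ r) :
    Tendsto (fun k => smoothPairing (g k) α - smoothPairing (h k) α) l (𝓝 0) := by
  obtain ⟨c, hc⟩ := exists_smoothPairing_eq (n := n) hp
  simp only [hc _ (hg _), hc _ (hh _), ← Finset.sum_sub_distrib, ← mul_sub]
  rw [show (0 : ℝ) = ∑ K : MultiIndex n (n - p), ∑ L : MultiIndex n (n - p), c K L * 0 by simp]
  refine tendsto_finsetSum _ fun K _ => tendsto_finsetSum _ fun L _ => Tendsto.const_mul _ ?_
  obtain ⟨χ, c₁, hχ, hχ1⟩ := exists_isCutoffFamily p x₀ hr hrR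
  have hφ := α.contDiff_coeff K L
  have hφc := α.hasCompactSupport_coeff K L
  obtain ⟨c₂, hc₂, hφh⟩ := exists_abs_hess_le hφ hφc
  set c := max c₁ c₂
  have hχ' : IsCutoffFamily p χ c (Metric.ball x₀ R) := hχ.mono_const (le_max_left _ _)
  have hφχ : ∀ j x i k, |hess (fun x => α x K L) x i k| ≤ c * χ j x := by
    intro j x i k
    by_cases hx : x ∈ tsupport fun x => α x K L
    · rw [hχ1 j x (hα (α.tsupport_coeff_subset K L hx)), mul_one]
      exact (hφh x i k).trans (le_max_right _ _)
    · rw [hess_eq_zero_of_notMem hx]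
      simpa using mul_nonneg hχ'.const_nonneg (hχ'.nonneg j x)
  set M' := |M| + 1
  have hM' : 0 ≤ M' := by positivity
  refine tendsto_zero_of_abs_le (C := p * (n * c * 2 * ((n * c * M') ^ (p - 1) *
    (mixedDisc n 1 * ∫ x, χ 0 x)))) fun η hη hη1 => ?_
  have hev : ∀ {u : ι → Fin p → V n → ℝ},
      (∀ i, TendstoUniformlyOn (fun k => u k i) (f i) l (Metric.ball x₀ R)) →
      ∀ᶠ k in l, ∀ i, ∀ x ∈ Metric.ball x₀ R, |f i x - u k i x| ≤ η := by
    intro u hu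
    rw [eventually_all]
    intro i
    filter_upwards [Metric.tendstoUniformlyOn_iff.1 (hu i) η hη] with k hk x hx
    exact (hk x hx).le
  filter_upwards [hev hgf, hev hhf] with k hgk hhk
  have hb : ∀ {u : Fin p → V n → ℝ}, (∀ i, ∀ x ∈ Metric.ball x₀ R, |f i x - u i x| ≤ η) →
      ∀ i, ∀ x ∈ Metric.ball x₀ R, |u i x| ≤ M' := by
    intro u hu i x hx
    have h1 := hM i x hx
    have h2 := hu i x hx
    have h3 := abs_sub_abs_le_abs_sub (u i x) (f i x)
    rw [abs_sub_comm] at h3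
    have h4 := le_abs_self M
    simp only [M']
    linarith
  have H := abs_integral_sub_integral_mixedDisc_le hχ' (contDiff_slots hp (hg k))
    (convexOn_slots hp (hgc k)) (contDiff_slots hp (hh k)) (convexOn_slots hp (hhc k)) hM'
    (η := 2 * η) (by positivity) (s := firstSlots n p) (card_firstSlots hp).le
    (fun l _ x hx => slots_zero_induction (P := fun u => |u x| ≤ M') hp
      (fun i => hb hgk i x hx) (by simpa using hM') l)
    (fun l _ x hx => slots_zero_induction (P := fun u => |u x| ≤ M') hp
      (fun i => hb hhk i x hx) (by simpa using hM') l)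
    (fun l _ x hx => ?_) (isContraction_slots hp K L) hφ hφc hφχ
  · rw [card_firstSlots hp] at H
    refine H.trans (le_of_eq ?_)
    ring
  · by_cases hl : (l : ℕ) < p
    · rw [slots_of_lt hp _ _ hl, slots_of_lt hp _ _ hl]
      have h1 := hgk ⟨l, hl⟩ x hx
      have h2 := hhk ⟨l, hl⟩ x hx
      rw [abs_le] at h1 h2 ⊢
      constructor <;> linarith [h1.1, h1.2, h2.1, h2.2]
    · rw [slots_of_not_lt hp _ _ hl, slots_of_not_lt hp _ _ hl]
      simpa using hη.le

/-! ### Existence of the intersection current -/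

/-- Smooth convex functions `G k i` converging to `f i`, uniformly on compact sets. -/
structure IsApproximation (G : ℕ → Fin p → V n → ℝ) (f : Fin p → V n → ℝ) : Prop where
  contDiff : ∀ k i, ContDiff ℝ ∞ (G k i)
  convexOn : ∀ k i, ConvexOn ℝ univ (G k i)
  tendsto : ∀ i, TendstoLocallyUniformly (fun k => G k i) (f i) atTop

theorem IsApproximation.tendstoUniformlyOn_ball {G : ℕ → Fin p → V n → ℝ} {f : Fin p → V n → ℝ}
    (hG : IsApproximation G f) (i : Fin p) (x₀ : V n) (R : ℝ) :
    TendstoUniformlyOn (fun k => G k i) (f i) atTop (Metric.ball x₀ R) :=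
  ((tendstoLocallyUniformly_iff_forall_isCompact.1 (hG.tendsto i)) _
    (isCompact_closedBall x₀ R)).mono Metric.ball_subset_closedBall

theorem IsApproximation.continuous {G : ℕ → Fin p → V n → ℝ} {f : Fin p → V n → ℝ}
    (hG : IsApproximation G f) (i : Fin p) : Continuous (f i) :=
  (hG.tendsto i).continuous (Frequently.of_forall fun k => (hG.contDiff k i).continuous)

theorem exists_abs_le_on_ball {f : Fin p → V n → ℝ} (hf : ∀ i, Continuous (f i)) (x₀ : V n)
    (R : ℝ) : ∃ M, 0 ≤ M ∧ ∀ i, ∀ x ∈ Metric.ball x₀ R, |f i x| ≤ M := by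
  choose M hM using fun i => (isCompact_closedBall x₀ R).exists_bound_of_continuousOn
    (hf i).continuousOn
  refine ⟨∑ i, |M i|, by positivity, fun i x hx => ?_⟩
  exact (hM i x (Metric.ball_subset_closedBall hx)).trans ((le_abs_self _).trans
    (Finset.single_le_sum (f := fun i => |M i|) (fun i _ => abs_nonneg _) (Finset.mem_univ i)))

theorem TestForm.exists_tsupport_subset {q : ℕ} (α : TestForm n q) :
    ∃ r > 0, tsupport α ⊆ Metric.closedBall 0 r := by
  obtain ⟨r, hr⟩ := (TestFunction.hasCompactSupport α).isBounded.subset_closedBall 0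
  exact ⟨max r 1, by positivity, hr.trans (Metric.closedBall_subset_closedBall (le_max_left _ _))⟩

/-- Any two approximations have the same limit pairings. -/
theorem IsApproximation.tendsto_sub (hp : p ≤ n) {G H : ℕ → Fin p → V n → ℝ}
    {f : Fin p → V n → ℝ} (hG : IsApproximation G f) (hH : IsApproximation H f)
    (α : TestForm n (n - p)) :
    Tendsto (fun k => smoothPairing (G k) α - smoothPairing (H k) α) atTop (𝓝 0) := by
  obtain ⟨r, hr, hα⟩ := α.exists_tsupport_subset
  obtain ⟨M, -, hM⟩ := exists_abs_le_on_ball hG.continuous 0 (r + 1)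
  exact tendsto_smoothPairing_sub hp hG.contDiff hG.convexOn hH.contDiff hH.convexOn hr
    (lt_add_one r) (fun i => hG.tendstoUniformlyOn_ball i _ _)
    (fun i => hH.tendstoUniformlyOn_ball i _ _) hM hα

/-- The pairings form a Cauchy sequence: the comparison of two approximations is applied to the
sequence and itself, along pairs of indices. -/
theorem IsApproximation.exists_tendsto (hp : p ≤ n) {G : ℕ → Fin p → V n → ℝ}
    {f : Fin p → V n → ℝ} (hG : IsApproximation G f) (α : TestForm n (n - p)) :
    ∃ t, Tendsto (fun k => smoothPairing (G k) α) atTop (𝓝 t) := by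
  obtain ⟨r, hr, hα⟩ := α.exists_tsupport_subset
  obtain ⟨M, -, hM⟩ := exists_abs_le_on_ball hG.continuous 0 (r + 1)
  have h := tendsto_smoothPairing_sub hp (ι := ℕ × ℕ) (l := atTop)
    (g := fun k => G k.1) (h := fun k => G k.2) (fun k => hG.contDiff _)
    (fun k => hG.convexOn _) (fun k => hG.contDiff _) (fun k => hG.convexOn _) hr (lt_add_one r)
    (fun i u hu => (tendsto_fst.comp prod_atTop_atTop_eq.ge).eventually
      (hG.tendstoUniformlyOn_ball i _ _ u hu))
    (fun i u hu => (tendsto_snd.comp prod_atTop_atTop_eq.ge).eventually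
      (hG.tendstoUniformlyOn_ball i _ _ u hu)) hM hα
  refine cauchySeq_tendsto_of_complete ?_
  rw [cauchySeq_iff_tendsto_dist_atTop_0]
  simpa [Real.dist_eq] using h.abs

/-- The limits of the pairings with an approximating sequence form a current. It is continuous, as the
masses of the approximating currents on a compact set are bounded. -/
theorem IsApproximation.exists_current (hp : p ≤ n) {G : ℕ → Fin p → V n → ℝ}
    {f : Fin p → V n → ℝ} (hG : IsApproximation G f) :
    ∃ T : Current n p, ∀ α, Tendsto (fun k => smoothPairing (G k) α) atTop (𝓝 (T α)) := by
  choose T hT using hG.exists_tendsto hp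
  choose S hS using fun k => exists_smoothPairing_linear hp (hG.contDiff k)
  have hadd : ∀ α β, T (α + β) = T α + T β := fun α β => by
    refine tendsto_nhds_unique (hT _) (((hT α).add (hT β)).congr fun k => ?_)
    rw [← hS, ← hS, ← hS, map_add]
  have hsmul : ∀ (c : ℝ) α, T (c • α) = c • T α := fun c α => by
    refine tendsto_nhds_unique (hT _) (((hT α).const_smul c).congr fun k => ?_)
    rw [← hS, ← hS, map_smul]
  obtain ⟨C, hC, hbound⟩ := exists_abs_smoothPairing_le n hp
  refine ⟨TestFunction.mkCLM ℝ T hadd hsmul fun K hK => ?_, hT⟩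
  -- On forms supported in `K`, the limit functional is bounded by the sup norm.
  obtain ⟨r, hr⟩ := K.isCompact.isBounded.subset_closedBall (0 : V n)
  set r' := max r 1
  have hr' : (0 : ℝ) < r' := by positivity
  obtain ⟨χ, c, hχ, hχ1⟩ := exists_isCutoffFamily p (0 : V n) hr' (lt_add_one r')
  obtain ⟨M, hM0, hM⟩ := exists_abs_le_on_ball hG.continuous 0 (r' + 1)
  have hev : ∀ᶠ k in atTop, ∀ i, ∀ x ∈ Metric.ball (0 : V n) (r' + 1), |G k i x| ≤ M + 1 := by
    rw [eventually_all]
    intro i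
    filter_upwards [Metric.tendstoUniformlyOn_iff.1 (hG.tendstoUniformlyOn_ball i 0 (r' + 1)) 1
      one_pos] with k hk x hx
    have h1 := hk x hx
    rw [Real.dist_eq, abs_sub_comm] at h1
    have h2 := abs_sub_abs_le_abs_sub (G k i x) (f i x)
    linarith [hM i x hx]
  set D := C * ((c * (M + 1)) ^ p * ∫ x, χ 0 x)
  have hTb : ∀ α : ContDiffMapSupportedIn (V n)
      (MultiIndex n (n - p) → MultiIndex n (n - p) → ℝ) ⊤ K,
      |T (TestFunction.ofSupportedIn hK α)| ≤
        D * ‖ContDiffMapSupportedIn.toBoundedContinuousFunctionCLM ℝ α‖ := by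
    intro α
    refine le_of_tendsto (hT _).abs (hev.mono fun k hk => ?_)
    refine (hbound hχ le_rfl (G k) (hG.contDiff k) (hG.convexOn k) (M + 1) (by positivity) hk
      (TestFunction.ofSupportedIn hK α)
      ‖ContDiffMapSupportedIn.toBoundedContinuousFunctionCLM ℝ α‖ (norm_nonneg _) fun x => ?_).trans
      (le_of_eq (by simp only [D]; ring))
    by_cases hx : x ∈ K
    · rw [hχ1 p x (Metric.closedBall_subset_closedBall (le_max_left _ _) (hr hx)), mul_one]
      exact (ContDiffMapSupportedIn.toBoundedContinuousFunctionCLM ℝ α).norm_coe_le_norm x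
    · have h0 : (TestFunction.ofSupportedIn hK α) x = 0 := α.zero_on_compl hx
      rw [h0, norm_zero]
      exact mul_nonneg (norm_nonneg _) (hχ.nonneg _ _)
  let Φ : ContDiffMapSupportedIn (V n)
      (MultiIndex n (n - p) → MultiIndex n (n - p) → ℝ) ⊤ K →+ ℝ :=
    { toFun := T ∘ TestFunction.ofSupportedIn hK
      map_zero' := by
        have h0 : T 0 = 0 := by simpa using hsmul 0 0
        exact h0
      map_add' := fun α β => by
        exact hadd (TestFunction.ofSupportedIn hK α) (TestFunction.ofSupportedIn hK β) }
  change Continuous Φ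
  refine continuous_of_continuousAt_zero Φ ?_
  rw [ContinuousAt, map_zero]
  refine squeeze_zero_norm hTb ?_
  have := ((ContDiffMapSupportedIn.toBoundedContinuousFunctionCLM ℝ (E := V n)
    (F := MultiIndex n (n - p) → MultiIndex n (n - p) → ℝ) (n := ⊤) (K := K)).continuous.norm.const_mul
      D).tendsto 0
  rwa [map_zero, norm_zero, mul_zero] at this

theorem IsApproximation.isIntersectionCurrent (hp : p ≤ n) {G : ℕ → Fin p → V n → ℝ}
    {f : Fin p → V n → ℝ} (hG : IsApproximation G f) {T : Current n p}
    (hT : ∀ α, Tendsto (fun k => smoothPairing (G k) α) atTop (𝓝 (T α))) :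
    IsIntersectionCurrent f T := by
  intro g hg hgc hgf α
  have h := (IsApproximation.tendsto_sub hp ⟨hg, hgc, hgf⟩ hG α).add (hT α)
  simpa using h

theorem IsApproximation.existsUnique (hp : p ≤ n) {G : ℕ → Fin p → V n → ℝ}
    {f : Fin p → V n → ℝ} (hG : IsApproximation G f) :
    ∃! T : Current n p, IsIntersectionCurrent f T := by
  obtain ⟨T, hT⟩ := hG.exists_current hp
  refine ⟨T, hG.isIntersectionCurrent hp hT, fun T' hT' => ?_⟩
  ext α
  exact tendsto_nhds_unique (hT' G hG.contDiff hG.convexOn hG.tendsto α) (hT α)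

/-! ### Smoothing of tropical polynomials -/

/-- The linear form `x ↦ a · x`. -/
noncomputable def linForm (a : Fin n → ℤ) : V n →L[ℝ] ℝ :=
  ∑ j, (a j : ℝ) • EuclideanSpace.proj j

/-- The tropical monomial `x ↦ -ν(a) + a · x`. -/
noncomputable def monomialFun (ν : (Fin n → ℤ) → ℝ) (a : Fin n → ℤ) (x : V n) : ℝ :=
  -ν a + linForm a x

theorem monomialFun_eq (ν : (Fin n → ℤ) → ℝ) (a : Fin n → ℤ) (x : V n) :
    monomialFun ν a x = -ν a + ∑ i, (a i : ℝ) * x i := by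
  simp [monomialFun, linForm, sum_apply]

theorem monomialFun_add (ν : (Fin n → ℤ) → ℝ) (a : Fin n → ℤ) (x w : V n) :
    monomialFun ν a (x + w) = monomialFun ν a x + linForm a w := by
  simp [monomialFun, add_assoc]

theorem contDiff_monomialFun (ν : (Fin n → ℤ) → ℝ) (a : Fin n → ℤ) :
    ContDiff ℝ ∞ (monomialFun ν a) :=
  contDiff_const.add (linForm a).contDiff

/-- The smoothing `(k+1)⁻¹ log ∑_a exp((k+1)(-ν(a) + a · x))` of the tropical polynomial with
exponents in `B`. -/
noncomputable def softMax (ν : (Fin n → ℤ) → ℝ) (B : Finset (Fin n → ℤ)) (k : ℕ) (x : V n) : ℝ :=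
  ((k : ℝ) + 1)⁻¹ * Real.log (∑ a ∈ B, Real.exp ((k + 1) * monomialFun ν a x))

theorem sum_exp_pos (ν : (Fin n → ℤ) → ℝ) {B : Finset (Fin n → ℤ)} (hB : B.Nonempty) (k : ℕ)
    (x : V n) : 0 < ∑ a ∈ B, Real.exp ((k + 1) * monomialFun ν a x) :=
  Finset.sum_pos (fun _ _ => Real.exp_pos _) hB

theorem contDiff_softMax (ν : (Fin n → ℤ) → ℝ) {B : Finset (Fin n → ℤ)} (hB : B.Nonempty) (k : ℕ) :
    ContDiff ℝ ∞ (softMax ν B k) := by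
  refine contDiff_const.mul (ContDiff.log (ContDiff.sum fun a _ => ?_)
    fun x => (sum_exp_pos ν hB k x).ne')
  exact (contDiff_const.mul (contDiff_monomialFun ν a)).exp

theorem convexOn_softMax (ν : (Fin n → ℤ) → ℝ) {B : Finset (Fin n → ℤ)} (hB : B.Nonempty) (k : ℕ) :
    ConvexOn ℝ univ (softMax ν B k) := by
  refine ⟨convex_univ, fun x _ y _ s t hs ht hst => ?_⟩
  have hX := sum_exp_pos ν hB k x
  have hY := sum_exp_pos ν hB k y
  have hZ := sum_exp_pos ν hB k (s • x + t • y)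
  set K : ℝ := (k : ℝ) + 1
  have hK : 0 < K := by positivity
  set X := ∑ a ∈ B, Real.exp (K * monomialFun ν a x)
  set Y := ∑ a ∈ B, Real.exp (K * monomialFun ν a y)
  have h : Real.log (∑ a ∈ B, Real.exp (K * monomialFun ν a (s • x + t • y))) ≤
      s * Real.log X + t * Real.log Y := by
    rw [Real.log_le_iff_le_exp hZ]
    -- After normalisation by `X` and `Y`, this is the convexity of `exp` in each summand.
    calc ∑ a ∈ B, Real.exp (K * monomialFun ν a (s • x + t • y))
        ≤ ∑ a ∈ B, Real.exp (s * Real.log X + t * Real.log Y) *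
          (s * (Real.exp (K * monomialFun ν a x) / X) +
            t * (Real.exp (K * monomialFun ν a y) / Y)) := by
          refine Finset.sum_le_sum fun a _ => ?_
          have h1 := convexOn_exp.2 (mem_univ (K * monomialFun ν a x - Real.log X))
            (mem_univ (K * monomialFun ν a y - Real.log Y)) hs ht hst
          simp only [smul_eq_mul, Real.exp_sub, Real.exp_log hX, Real.exp_log hY] at h1
          have h2 : K * monomialFun ν a (s • x + t • y) = (s * Real.log X + t * Real.log Y) +
              (s * (K * monomialFun ν a x - Real.log X) +
                t * (K * monomialFun ν a y - Real.log Y)) := by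
            have : t = 1 - s := by linarith
            simp only [monomialFun, map_add, map_smul, smul_eq_mul, this]
            ring
          rw [h2, Real.exp_add]
          exact mul_le_mul_of_nonneg_left h1 (Real.exp_pos _).le
      _ = Real.exp (s * Real.log X + t * Real.log Y) * (s * (X / X) + t * (Y / Y)) := by
          rw [← Finset.mul_sum, Finset.sum_add_distrib, ← Finset.mul_sum, ← Finset.mul_sum,
            ← Finset.sum_div, ← Finset.sum_div]
      _ = _ := by rw [div_self hX.ne', div_self hY.ne', mul_one, mul_one, hst, mul_one]
  simp only [softMax, smul_eq_mul]
  calc K⁻¹ * Real.log (∑ a ∈ B, Real.exp (K * monomialFun ν a (s • x + t • y)))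
      ≤ K⁻¹ * (s * Real.log X + t * Real.log Y) := by gcongr
    _ = _ := by ring

theorem abs_sup'_sub_softMax_le (ν : (Fin n → ℤ) → ℝ) {B : Finset (Fin n → ℤ)} (hB : B.Nonempty)
    (k : ℕ) (x : V n) :
    |B.sup' hB (fun a => monomialFun ν a x) - softMax ν B k x| ≤
      Real.log B.card * (1 / ((k : ℝ) + 1)) := by
  have hX := sum_exp_pos ν hB k x
  set m := B.sup' hB (fun a => monomialFun ν a x) with hm
  have hK : (0 : ℝ) < (k : ℝ) + 1 := by positivity
  have hcard : (0 : ℝ) < B.card := by exact_mod_cast hB.card_pos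
  have h1 : ((k : ℝ) + 1) * m ≤
      Real.log (∑ a ∈ B, Real.exp ((k + 1) * monomialFun ν a x)) := by
    obtain ⟨a, ha, hma⟩ := Finset.exists_mem_eq_sup' hB fun a => monomialFun ν a x
    rw [Real.le_log_iff_exp_le hX, hm, hma]
    exact Finset.single_le_sum (f := fun a => Real.exp ((k + 1) * monomialFun ν a x))
      (fun _ _ => (Real.exp_pos _).le) ha
  have h2 : Real.log (∑ a ∈ B, Real.exp ((k + 1) * monomialFun ν a x)) ≤
      Real.log B.card + ((k : ℝ) + 1) * m := by
    rw [Real.log_le_iff_le_exp hX, Real.exp_add, Real.exp_log hcard]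
    refine (Finset.sum_le_card_nsmul B _ (Real.exp (((k : ℝ) + 1) * m)) fun a ha => ?_).trans
      (le_of_eq (by rw [nsmul_eq_mul]))
    gcongr
    exact Finset.le_sup' (fun a => monomialFun ν a x) ha
  have h3 : m ≤ softMax ν B k x := by
    rw [softMax, le_inv_mul_iff₀ hK]; exact h1
  have h4 : softMax ν B k x ≤ m + Real.log B.card * (1 / ((k : ℝ) + 1)) := by
    rw [softMax, inv_mul_le_iff₀ hK]
    refine h2.trans (le_of_eq ?_)
    field_simp
    ring
  rw [abs_le]
  constructor <;> linarith [mul_nonneg (Real.log_natCast_nonneg B.card)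
    (one_div_nonneg.2 hK.le)]

theorem tendstoUniformly_softMax (ν : (Fin n → ℤ) → ℝ) {B : Finset (Fin n → ℤ)} (hB : B.Nonempty) :
    TendstoUniformly (fun k => softMax ν B k) (fun x => B.sup' hB fun a => monomialFun ν a x)
      atTop := by
  rw [Metric.tendstoUniformly_iff]
  intro ε hε
  have h : Tendsto (fun k : ℕ => Real.log B.card * (1 / ((k : ℝ) + 1))) atTop (𝓝 0) := by
    simpa using (tendsto_one_div_add_atTop_nhds_zero_nat (𝕜 := ℝ)).const_mul (Real.log B.card)
  filter_upwards [h.eventually (gt_mem_nhds hε)] with k hk x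
  exact (abs_sup'_sub_softMax_le ν hB k x).trans_lt hk

/-- A tuple of tropical polynomials, given by their exponents and coefficients. -/
structure TropicalData (n p : ℕ) where
  /-- The exponents of the polynomials. -/
  supp : Fin p → Finset (Fin n → ℤ)
  supp_nonempty : ∀ i, (supp i).Nonempty
  /-- The negatives of the coefficients. -/
  coeff : Fin p → (Fin n → ℤ) → ℝ

namespace TropicalData

variable (P : TropicalData n p)

/-- The tropical polynomials as functions. -/
noncomputable def toFun (i : Fin p) (x : V n) : ℝ :=
  (P.supp i).sup' (P.supp_nonempty i) fun a => monomialFun (P.coeff i) a x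

theorem isApproximation_softMax :
    IsApproximation (fun k i => softMax (P.coeff i) (P.supp i) k) P.toFun where
  contDiff k i := contDiff_softMax _ (P.supp_nonempty i) k
  convexOn k i := convexOn_softMax _ (P.supp_nonempty i) k
  tendsto i := (tendstoUniformly_softMax _ (P.supp_nonempty i)).tendstoLocallyUniformly

theorem continuous_toFun (i : Fin p) : Continuous (P.toFun i) :=
  P.isApproximation_softMax.continuous i

/-! ### The cell structure of a tuple of tropical polynomials -/

/-- The exponents of the `i`-th polynomial at which the maximum is attained at `x`. -/
noncomputable def active (x : V n) (i : Fin p) : Finset (Fin n → ℤ) :=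
  (P.supp i).filter fun a => monomialFun (P.coeff i) a x = P.toFun i x

theorem mem_active {x : V n} {i : Fin p} {a : Fin n → ℤ} :
    a ∈ P.active x i ↔ a ∈ P.supp i ∧ monomialFun (P.coeff i) a x = P.toFun i x := by
  simp [active]

theorem active_nonempty (x : V n) (i : Fin p) : (P.active x i).Nonempty := by
  obtain ⟨a, ha, h⟩ := Finset.exists_mem_eq_sup' (P.supp_nonempty i) fun a =>
    monomialFun (P.coeff i) a x
  exact ⟨a, P.mem_active.2 ⟨ha, h.symm⟩⟩

theorem monomialFun_le {i : Fin p} {a : Fin n → ℤ} (ha : a ∈ P.supp i) (x : V n) :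
    monomialFun (P.coeff i) a x ≤ P.toFun i x :=
  Finset.le_sup' (fun a => monomialFun (P.coeff i) a x) ha

theorem eventually_active_subset (x : V n) : ∀ᶠ y in 𝓝 x, ∀ i, P.active y i ⊆ P.active x i := by
  rw [eventually_all]
  intro i
  have h : ∀ a ∈ P.supp i, ∀ᶠ y in 𝓝 x, a ∈ P.active y i → a ∈ P.active x i := by
    intro a ha
    by_cases hax : a ∈ P.active x i
    · exact Eventually.of_forall fun _ _ => hax
    · have hlt : monomialFun (P.coeff i) a x < P.toFun i x :=
        lt_of_le_of_ne (P.monomialFun_le ha x) fun h => hax (P.mem_active.2 ⟨ha, h⟩)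
      filter_upwards [(contDiff_monomialFun _ a).continuous.continuousAt.eventually_lt
        (P.continuous_toFun i).continuousAt hlt] with y hy hay
      exact absurd (P.mem_active.1 hay).2 hy.ne
  filter_upwards [(Finset.eventually_all _).2 h] with y hy a ha
  exact hy a (P.mem_active.1 ha).1 ha

theorem toFun_eq_sup'_of_active_subset {x y : V n} {i : Fin p}
    (h : P.active y i ⊆ P.active x i) :
    P.toFun i y = (P.active x i).sup' (P.active_nonempty x i)
      fun a => monomialFun (P.coeff i) a y := by
  refine le_antisymm ?_ (Finset.sup'_le _ _ fun a ha => P.monomialFun_le (P.mem_active.1 ha).1 y)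
  obtain ⟨a, ha⟩ := P.active_nonempty y i
  rw [← (P.mem_active.1 ha).2]
  exact Finset.le_sup' (fun a => monomialFun (P.coeff i) a y) (h ha)

end TropicalData

/-- The directions along which, for every `i`, the linear forms with exponents in `B i` coincide. -/
noncomputable def lineality (B : Fin p → Finset (Fin n → ℤ)) : Submodule ℝ (V n) where
  carrier := {w | ∀ i, ∀ a ∈ B i, ∀ b ∈ B i, linForm a w = linForm b w}
  add_mem' hv hw i a ha b hb := by simp [hv i a ha b hb, hw i a ha b hb]
  zero_mem' := by simp
  smul_mem' c w hw i a ha b hb := by simp [hw i a ha b hb]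

theorem lineality_anti {B B' : Fin p → Finset (Fin n → ℤ)} (h : ∀ i, B i ⊆ B' i) :
    lineality B' ≤ lineality B := fun _ hw i a ha b hb => hw i a (h i ha) b (h i hb)

namespace TropicalData

variable (P : TropicalData n p)

theorem sub_mem_lineality {x y : V n} (h : ∀ i, P.active y i ⊆ P.active x i) :
    y - x ∈ lineality (P.active y) := by
  intro i a ha b hb
  have h1 := (P.mem_active.1 ha).2.trans (P.mem_active.1 hb).2.symm
  have h2 := (P.mem_active.1 (h i ha)).2.trans (P.mem_active.1 (h i hb)).2.symm
  simp only [monomialFun] at h1 h2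
  simp only [map_sub]
  linarith

theorem active_eq_of_sub_mem_lineality {x y : V n} (h : ∀ i, P.active y i ⊆ P.active x i)
    (hxy : y - x ∈ lineality (P.active x)) : P.active y = P.active x := by
  funext i
  refine (h i).antisymm fun a ha => ?_
  obtain ⟨b, hb⟩ := P.active_nonempty y i
  refine P.mem_active.2 ⟨(P.mem_active.1 ha).1, ?_⟩
  rw [← (P.mem_active.1 hb).2]
  have h1 := (P.mem_active.1 ha).2.trans (P.mem_active.1 (h i hb)).2.symm
  have h2 := hxy i a ha b (h i hb)
  simp only [monomialFun, map_sub] at h1 h2 ⊢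
  linarith

/-- Passing from a point `x` to a nearby point outside of its cell increases the dimension of the
cell. -/
theorem finrank_lineality_lt {x y : V n} (h : ∀ i, P.active y i ⊆ P.active x i)
    (hne : P.active y ≠ P.active x) :
    Module.finrank ℝ (lineality (P.active x)) < Module.finrank ℝ (lineality (P.active y)) := by
  refine Submodule.finrank_lt_finrank_of_lt (lt_of_le_of_ne (lineality_anti h) fun heq => hne ?_)
  exact P.active_eq_of_sub_mem_lineality h (heq ▸ P.sub_mem_lineality h)

/-- The linear forms with exponents in `B i` vary together along the lineality space, and so the
smoothing of their maximum changes by a constant. -/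
theorem exists_softMax_add {B : Fin p → Finset (Fin n → ℤ)} (hB : ∀ i, (B i).Nonempty) {w : V n}
    (hw : w ∈ lineality B) (i : Fin p) (ν : (Fin n → ℤ) → ℝ) (k : ℕ) :
    ∃ c, ∀ z, softMax ν (B i) k (z + w) = softMax ν (B i) k z + c := by
  obtain ⟨b, hb⟩ := hB i
  refine ⟨linForm b w, fun z => ?_⟩
  have h1 : ∑ a ∈ B i, Real.exp ((k + 1) * monomialFun ν a (z + w)) =
      Real.exp ((k + 1) * linForm b w) * ∑ a ∈ B i, Real.exp ((k + 1) * monomialFun ν a z) := by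
    rw [Finset.mul_sum]
    refine Finset.sum_congr rfl fun a ha => ?_
    rw [monomialFun_add, hw i a ha b hb, ← Real.exp_add]
    ring_nf
  have hK : ((k : ℝ) + 1) ≠ 0 := by positivity
  rw [softMax, h1, Real.log_mul (Real.exp_ne_zero _) (sum_exp_pos ν ⟨b, hb⟩ k z).ne', Real.log_exp,
    softMax]
  field_simp
  ring

end TropicalData

theorem pderiv_add_of_forall_add {F : V n → ℝ} {w : V n} {c : ℝ} (h : ∀ z, F (z + w) = F z + c)
    (j : Fin n) (z : V n) : pderiv j F (z + w) = pderiv j F z := by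
  have h1 : (fun z => F (z + w)) = fun z => F z + c := funext h
  have h2 : fderiv ℝ (fun z => F (z + w)) z = fderiv ℝ F (z + w) := fderiv_comp_add_right w
  rw [pderiv, ← h2, h1, fderiv_add_const]
  rfl

theorem hess_add_of_forall_add {F : V n → ℝ} {w : V n} {c : ℝ} (h : ∀ z, F (z + w) = F z + c)
    (z : V n) : hess F (z + w) = hess F z := by
  ext i j
  exact pderiv_add_of_forall_add (c := 0)
    (fun z => by rw [pderiv_add_of_forall_add h, add_zero]) i z

/-- If a function changes by constants under translations along `w`, its Hessian kills `w`. -/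
theorem sum_hess_mul_eq_zero {F : V n → ℝ} (hF : ContDiff ℝ ∞ F) {w : V n}
    (h : ∀ t : ℝ, ∃ c, ∀ z, F (z + t • w) = F z + c) (z : V n) (j : Fin n) :
    ∑ i, hess F z i j * w i = 0 := by
  have h1 := hasDerivAt_comp_line (differentiable_of_smooth (contDiff_pderiv hF j)) z w 0
  have h2 : (fun t : ℝ => pderiv j F (z + t • w)) = fun _ => pderiv j F z := by
    funext t
    obtain ⟨c, hc⟩ := h t
    exact pderiv_add_of_forall_add hc j z
  rw [h2, zero_smul, add_zero] at h1
  have h3 := h1.unique (hasDerivAt_const _ _)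
  have hw : w = ∑ i, w i • EuclideanSpace.single i (1 : ℝ) := by
    ext j
    simp [Pi.single_apply]
  rw [hw, map_sum] at h3
  rw [← h3]
  refine Finset.sum_congr rfl fun i _ => ?_
  rw [map_smul, smul_eq_mul, mul_comm]
  rfl

/-! ### Supports of currents -/

/-- The product of a test form with a smooth function. -/
noncomputable def TestForm.smulFun {q : ℕ} (ψ : V n → ℝ) (hψ : ContDiff ℝ ∞ ψ) (α : TestForm n q) :
    TestForm n q where
  toFun x := ψ x • α x
  contDiff' := hψ.smul (TestFunction.contDiff α)
  hasCompactSupport' := HasCompactSupport.intro (TestFunction.hasCompactSupport α) fun x hx => by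
    rw [image_eq_zero_of_notMem_tsupport hx, smul_zero]
  tsupport_subset' := fun _ _ => trivial

theorem TestForm.smulFun_apply {q : ℕ} (ψ : V n → ℝ) (hψ : ContDiff ℝ ∞ ψ) (α : TestForm n q)
    (x : V n) : TestForm.smulFun ψ hψ α x = ψ x • α x := rfl

theorem TestForm.tsupport_smulFun_subset {q : ℕ} (ψ : V n → ℝ) (hψ : ContDiff ℝ ∞ ψ)
    (α : TestForm n q) : tsupport (TestForm.smulFun ψ hψ α) ⊆ tsupport ψ ∧
      tsupport (TestForm.smulFun ψ hψ α) ⊆ tsupport α := by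
  constructor <;> refine closure_mono fun x hx => ?_ <;> rw [Function.mem_support] at hx ⊢ <;>
    refine fun h0 => hx ?_ <;> simp [TestForm.smulFun_apply, h0]

/-- The translate `z ↦ α(z + w)` of a test form. -/
noncomputable def TestForm.translate {q : ℕ} (w : V n) (α : TestForm n q) : TestForm n q where
  toFun z := α (z + w)
  contDiff' := (TestFunction.contDiff α).comp (contDiff_id.add contDiff_const)
  hasCompactSupport' := (TestFunction.hasCompactSupport α).comp_homeomorph (Homeomorph.addRight w)
  tsupport_subset' := fun _ _ => trivial

theorem TestForm.tsupport_translate_subset {q : ℕ} {x w : V n} {r : ℝ} {α : TestForm n q}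
    (h : tsupport α ⊆ Metric.closedBall (x + w) r) :
    tsupport (α.translate w) ⊆ Metric.closedBall x r := by
  refine closure_minimal (fun z hz => ?_) Metric.isClosed_closedBall
  have h1 := h (subset_tsupport α (show z + w ∈ Function.support α from hz))
  simpa using h1

/-- A current vanishes on the test forms whose support does not meet the support of the current. -/
theorem eq_zero_of_disjoint_dsupport (T : Current n p) {α : TestForm n (n - p)}
    (h : ∀ x ∈ tsupport α, x ∉ Distribution.dsupport T) : T α = 0 := by
  have h1 : ∀ x : tsupport α, ∃ U : Set (V n), Distribution.IsVanishingOn T U ∧ IsOpen U ∧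
      (x : V n) ∈ U := fun x => (Distribution.notMem_dsupport_iff _).1 (h x x.2)
  choose U hUv hUo hUx using h1
  obtain ⟨ρ, hρ⟩ := SmoothPartitionOfUnity.exists_isSubordinate (modelWithCornersSelf ℝ (V n))
    (isClosed_tsupport α) U hUo fun x hx => mem_iUnion.2 ⟨⟨x, hx⟩, hUx _⟩
  have hsm : ∀ i, ContDiff ℝ ∞ (ρ i) := fun i => (ρ i).contMDiff.contDiff
  have hfin := ρ.locallyFinite.finite_nonempty_inter_compact (TestFunction.hasCompactSupport α)
  have hsum : α = ∑ i ∈ hfin.toFinset, TestForm.smulFun (ρ i) (hsm i) α := by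
    ext1 x
    have : (∑ i ∈ hfin.toFinset, TestForm.smulFun (ρ i) (hsm i) α) x =
        ∑ i ∈ hfin.toFinset, ρ i x • α x := by
      simp [sum_apply, TestForm.smulFun_apply]
    rw [this, ← Finset.sum_smul]
    by_cases hx : x ∈ tsupport α
    · rw [← finsum_eq_sum_of_support_subset, ρ.sum_eq_one hx, one_smul]
      intro i hi
      simp only [Set.Finite.coe_toFinset]
      exact ⟨x, hi, hx⟩
    · rw [image_eq_zero_of_notMem_tsupport hx, smul_zero]
  rw [hsum, map_sum]
  refine Finset.sum_eq_zero fun i _ => hUv i _ ?_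
  exact (TestForm.tsupport_smulFun_subset _ _ α).1.trans (hρ i)

/-! ### Stretching transversally to a subspace -/

/-- The linear map which is the identity on `W` and the homothety of ratio `t` on its orthogonal
complement. -/
noncomputable def stretch (W : Submodule ℝ (V n)) (t : ℝ) : V n →L[ℝ] V n :=
  W.starProjection + t • (1 - W.starProjection)

theorem stretch_apply (W : Submodule ℝ (V n)) (t : ℝ) (v : V n) :
    stretch W t v = W.starProjection v + t • (v - W.starProjection v) := by
  simp [stretch]

theorem stretch_of_mem {W : Submodule ℝ (V n)} {v : V n} (hv : v ∈ W) (t : ℝ) :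
    stretch W t v = v := by
  simp [stretch_apply, Submodule.starProjection_eq_self_iff.2 hv]

theorem norm_sub_starProjection_le (W : Submodule ℝ (V n)) (v : V n) :
    ‖v - W.starProjection v‖ ≤ ‖v‖ := by
  rw [← Submodule.starProjection_orthogonal_val]
  exact Submodule.norm_starProjection_apply_le _ _

theorem starProjection_sub_starProjection (W : Submodule ℝ (V n)) (v : V n) :
    W.starProjection (v - W.starProjection v) = 0 := by
  rw [map_sub, Submodule.starProjection_eq_self_iff.2 (Submodule.starProjection_apply_mem W v),
    sub_self]

theorem starProjection_stretch (W : Submodule ℝ (V n)) (t : ℝ) (v : V n) :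
    W.starProjection (stretch W t v) = W.starProjection v := by
  rw [stretch_apply, map_add, map_smul, starProjection_sub_starProjection, smul_zero, add_zero,
    Submodule.starProjection_eq_self_iff.2 (Submodule.starProjection_apply_mem W v)]

theorem norm_starProjection_le_norm_stretch (W : Submodule ℝ (V n)) (t : ℝ) (v : V n) :
    ‖W.starProjection v‖ ≤ ‖stretch W t v‖ := by
  rw [← starProjection_stretch W t v]
  exact Submodule.norm_starProjection_apply_le _ _

theorem mul_norm_sub_starProjection_le (W : Submodule ℝ (V n)) {t : ℝ} (ht : 0 ≤ t) (v : V n) :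
    t * ‖v - W.starProjection v‖ ≤ ‖stretch W t v‖ := by
  have h : t • (v - W.starProjection v) =
      stretch W t v - W.starProjection (stretch W t v) := by
    rw [starProjection_stretch, stretch_apply]; abel
  calc t * ‖v - W.starProjection v‖ = ‖t • (v - W.starProjection v)‖ := by
        rw [norm_smul, Real.norm_of_nonneg ht]
    _ ≤ _ := by rw [h]; exact norm_sub_starProjection_le _ _

theorem norm_stretch_le (W : Submodule ℝ (V n)) {t : ℝ} (ht : 1 ≤ t) (v : V n) :
    ‖stretch W t v‖ ≤ 2 * t * ‖v‖ := by
  rw [stretch_apply]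
  refine (norm_add_le _ _).trans ?_
  rw [norm_smul, Real.norm_of_nonneg (by linarith)]
  have h1 := Submodule.norm_starProjection_apply_le W v
  have h2 := norm_sub_starProjection_le W v
  nlinarith [norm_nonneg v]

theorem norm_le_two_mul_norm_stretch (W : Submodule ℝ (V n)) {t : ℝ} (ht : 1 ≤ t) (v : V n) :
    ‖v‖ ≤ 2 * ‖stretch W t v‖ := by
  have h1 := norm_starProjection_le_norm_stretch W t v
  have h2 := mul_norm_sub_starProjection_le W (by linarith : 0 ≤ t) v
  have h3 : ‖v - W.starProjection v‖ ≤ t * ‖v - W.starProjection v‖ :=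
    le_mul_of_one_le_left (norm_nonneg _) ht
  calc ‖v‖ = ‖W.starProjection v + (v - W.starProjection v)‖ := by congr 1; abel
    _ ≤ ‖W.starProjection v‖ + ‖v - W.starProjection v‖ := norm_add_le _ _
    _ ≤ _ := by linarith

theorem det_stretch (W : Submodule ℝ (V n)) (t : ℝ) :
    LinearMap.det (stretch W t : V n →ₗ[ℝ] V n) = t ^ Module.finrank ℝ Wᗮ := by
  let e := W.prodEquivOfIsCompl Wᗮ (Submodule.isCompl_orthogonal W)
  have h : (stretch W t : V n →ₗ[ℝ] V n) = e.toLinearMap ∘ₗ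
      (LinearMap.prodMap (LinearMap.id : W →ₗ[ℝ] W) (t • (LinearMap.id : Wᗮ →ₗ[ℝ] Wᗮ))) ∘ₗ
        e.symm.toLinearMap := by
    rw [← LinearMap.comp_assoc, LinearEquiv.eq_comp_toLinearMap_symm]
    refine LinearMap.ext fun ⟨a, b⟩ => ?_
    have hb : W.starProjection (b : V n) = 0 := by
      rw [Submodule.starProjection_apply_eq_zero_iff]; exact b.2
    have ha : W.starProjection (a : V n) = a := Submodule.starProjection_eq_self_iff.2 a.2
    simp [e, stretch_apply, ha, hb]
  rw [h, LinearMap.det_conj, LinearMap.det_prodMap, LinearMap.det_id, LinearMap.det_smul,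
    LinearMap.det_id, one_mul, mul_one]

theorem integral_comp_stretch (W : Submodule ℝ (V n)) {t : ℝ} (ht : 0 < t) {β : V n → ℝ}
    (hβ : Continuous β) (x : V n) :
    ∫ z, β (stretch W t (z - x)) = (t ^ Module.finrank ℝ Wᗮ)⁻¹ * ∫ z, β z := by
  have h0 : 0 < t ^ Module.finrank ℝ Wᗮ := by positivity
  have hdet : LinearMap.det (stretch W t : V n →ₗ[ℝ] V n) ≠ 0 := by
    rw [det_stretch]; exact h0.ne'
  rw [integral_sub_right_eq_self (fun z => β (stretch W t z)) x]
  have h1 := integral_map (μ := (volume : Measure (V n))) (φ := (stretch W t : V n →ₗ[ℝ] V n))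
    (stretch W t).continuous.aemeasurable (f := β) hβ.aestronglyMeasurable
  rw [Measure.map_linearMap_addHaar_eq_smul_addHaar _ hdet, det_stretch, integral_smul_measure,
    ENNReal.toReal_ofReal (abs_nonneg _), abs_of_pos (inv_pos.2 h0)] at h1
  exact h1.symm

theorem abs_apply_le_norm (v : V n) (i : Fin n) : |v i| ≤ ‖v‖ :=
  PiLp.norm_apply_le v i

theorem fderiv_comp_stretch {F : V n → ℝ} (hF : Differentiable ℝ F) (W : Submodule ℝ (V n)) (t : ℝ)
    (x z v : V n) : fderiv ℝ (fun z => F (stretch W t (z - x))) z v =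
      fderiv ℝ F (stretch W t (z - x)) (stretch W t v) := by
  have h1 : HasFDerivAt (fun z => stretch W t (z - x)) (stretch W t) z := by
    simp_rw [map_sub]
    exact (stretch W t).hasFDerivAt.sub_const _
  have h2 := (hF (stretch W t (z - x))).hasFDerivAt.comp z h1
  have h3 : fderiv ℝ (fun z => F (stretch W t (z - x))) z = _ := h2.fderiv
  rw [h3]
  rfl

theorem hess_comp_stretch {F : V n → ℝ} (hF : ContDiff ℝ ∞ F) (W : Submodule ℝ (V n)) (t : ℝ)
    (x z : V n) (i j : Fin n) : hess (fun z => F (stretch W t (z - x))) z i j =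
      fderiv ℝ (fderiv ℝ F) (stretch W t (z - x)) (stretch W t (EuclideanSpace.single i 1))
        (stretch W t (EuclideanSpace.single j 1)) := by
  have h1 : pderiv j (fun z => F (stretch W t (z - x))) = fun z =>
      (fun y => fderiv ℝ F y (stretch W t (EuclideanSpace.single j 1))) (stretch W t (z - x)) :=
    funext fun z => fderiv_comp_stretch (differentiable_of_smooth hF) W t x z _
  have h2 : ContDiff ℝ ∞ fun y => fderiv ℝ F y (stretch W t (EuclideanSpace.single j 1)) :=
    (hF.fderiv_right (m := ∞) (by simp)).clm_apply contDiff_const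
  change pderiv i (pderiv j fun z => F (stretch W t (z - x))) z = _
  rw [h1, pderiv, fderiv_comp_stretch (differentiable_of_smooth h2), fderiv_fderiv_apply hF]

theorem IsCutoffFamily.comp_stretch {N : ℕ} {χ : ℕ → V n → ℝ} {c R : ℝ}
    (h : IsCutoffFamily N χ c (Metric.ball 0 R)) (W : Submodule ℝ (V n)) {t : ℝ} (ht : 1 ≤ t)
    (x : V n) : IsCutoffFamily N (fun j z => χ j (stretch W t (z - x))) (c * (2 * n * t) ^ 2)
      {z | stretch W t (z - x) ∈ Metric.ball 0 R} where
  contDiff j := (h.contDiff j).comp ((stretch W t).contDiff.comp (contDiff_id.sub contDiff_const))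
  hasCompactSupport j := by
    refine HasCompactSupport.intro (isCompact_closedBall x (2 * R)) fun z hz => ?_
    by_contra h0
    have h1 := h.mem_of_ne_zero _ _ h0
    rw [mem_ball_zero_iff] at h1
    have h2 := norm_le_two_mul_norm_stretch W ht (z - x)
    rw [Metric.mem_closedBall, dist_eq_norm] at hz
    linarith
  nonneg j z := h.nonneg _ _
  const_nonneg := mul_nonneg h.const_nonneg (sq_nonneg _)
  mem_of_ne_zero j z hz := h.mem_of_ne_zero _ _ hz
  abs_hess_le j hj z i k := by
    rw [hess_comp_stretch (h.contDiff _), ← sum_sum_hess (h.contDiff _)]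
    set y := stretch W t (z - x)
    have h1 : ∀ i a, |stretch W t (EuclideanSpace.single i 1) a| ≤ 2 * t := fun i a =>
      (abs_apply_le_norm _ _).trans ((norm_stretch_le W ht _).trans (by simp))
    have hχ := mul_nonneg h.const_nonneg (h.nonneg j y)
    calc |∑ a, ∑ b, stretch W t (EuclideanSpace.single i 1) a * hess (χ (j + 1)) y a b *
          stretch W t (EuclideanSpace.single k 1) b|
        ≤ ∑ a : Fin n, ∑ b : Fin n, 2 * t * (c * χ j y) * (2 * t) := by
          refine (Finset.abs_sum_le_sum_abs _ _).trans (Finset.sum_le_sum fun a _ => ?_)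
          refine (Finset.abs_sum_le_sum_abs _ _).trans (Finset.sum_le_sum fun b _ => ?_)
          rw [abs_mul, abs_mul]
          have := h1 i a
          have := h1 k b
          have := h.abs_hess_le j hj y a b
          gcongr
      _ = c * (2 * n * t) ^ 2 * χ j y := by
          simp only [Finset.sum_const, Finset.card_univ, Fintype.card_fin, nsmul_eq_mul]
          ring

/-! ### The support of the intersection current -/

theorem pderiv_monomialFun (ν : (Fin n → ℤ) → ℝ) (a : Fin n → ℤ) (j : Fin n) :
    pderiv j (monomialFun ν a) = fun _ => linForm a (EuclideanSpace.single j 1) := by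
  ext x
  have h : HasFDerivAt (monomialFun ν a) (linForm a) x :=
    (linForm a).hasFDerivAt.const_add (-ν a)
  rw [pderiv, h.fderiv]

theorem hess_monomialFun (ν : (Fin n → ℤ) → ℝ) (a : Fin n → ℤ) (x : V n) :
    hess (monomialFun ν a) x = 0 := by
  ext i j
  simp only [hess, Matrix.of_apply, pderiv_monomialFun]
  simp [pderiv]

theorem convexOn_sub_monomialFun {F : V n → ℝ} (hF : ConvexOn ℝ univ F) (ν : (Fin n → ℤ) → ℝ)
    (a : Fin n → ℤ) : ConvexOn ℝ univ fun x => F x - monomialFun ν a x := by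
  refine ⟨convex_univ, fun x _ y _ s t hs ht hst => ?_⟩
  have h1 := hF.2 (mem_univ x) (mem_univ y) hs ht hst
  have h2 : monomialFun ν a (s • x + t • y) = s * monomialFun ν a x + t * monomialFun ν a y := by
    have : t = 1 - s := by linarith
    simp only [monomialFun, map_add, map_smul, smul_eq_mul, this]
    ring
  simp only [smul_eq_mul] at h1 ⊢
  rw [h2]
  linarith

theorem eq_zero_of_forall_abs_le_div {u D : ℝ} (h : ∀ t : ℝ, 1 ≤ t → |u| ≤ D / t) : u = 0 := by
  have h1 : Tendsto (fun t : ℝ => D / t) atTop (𝓝 0) := tendsto_const_nhds.div_atTop tendsto_id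
  have h2 : |u| ≤ 0 := ge_of_tendsto h1 (by
    filter_upwards [eventually_ge_atTop 1] with t ht using h t ht)
  exact abs_nonpos_iff.1 h2

/-- Smooth functions which are, up to additive constants, invariant under translations along a
subspace of dimension larger than `n - p` have a vanishing product of `dd^#`s. -/
theorem smoothPairing_eq_zero_of_invariant (hp : p ≤ n) {g : Fin p → V n → ℝ}
    (hg : ∀ i, ContDiff ℝ ∞ (g i)) {W : Submodule ℝ (V n)} (hW : n < Module.finrank ℝ W + p)
    (hinv : ∀ i, ∀ w ∈ W, ∃ c, ∀ z, g i (z + w) = g i z + c) (α : TestForm n (n - p)) :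
    smoothPairing g α = 0 := by
  obtain ⟨c, hc⟩ := exists_smoothPairing_eq (n := n) hp
  rw [hc g hg]
  refine Finset.sum_eq_zero fun K _ => Finset.sum_eq_zero fun L _ => ?_
  have h : ∀ x, mixedDisc n (formField hp g K L x) = 0 := fun x => by
    refine mixedDisc_eq_zero_of_kernel (firstSlots n p) _ W (by rwa [card_firstSlots hp])
      fun l hl w hw j => ?_
    have hlp : (l : ℕ) < p := by simpa [firstSlots] using hl
    rw [formField_eq, slots_of_lt hp _ _ hlp]
    exact sum_hess_mul_eq_zero (hg _) (fun t => hinv _ _ (W.smul_mem t hw)) x j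
  simp [h]

/-- The pairing is invariant under translations which leave the Hessians unchanged. -/
theorem smoothPairing_translate {g : Fin p → V n → ℝ} {w : V n}
    (hinv : ∀ i, ∃ c, ∀ z, g i (z + w) = g i z + c) (α : TestForm n (n - p)) :
    smoothPairing g (α.translate w) = smoothPairing g α := by
  have h : ∀ z, ddSharpProd g (z + w) = ddSharpProd g z := fun z => by
    have hh : ∀ i, hess (g i) (z + w) = hess (g i) z := fun i => by
      obtain ⟨c, hc⟩ := hinv i
      exact hess_add_of_forall_add hc z
    simp only [ddSharpProd, ddSharp_eq, hh]
  rw [smoothPairing, smoothPairing,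
    ← integral_add_right_eq_self (fun x => topCoeff n (ddSharpProd g x * TestForm.value α x)) w]
  simp only [h]
  rfl

namespace TropicalData

variable (P : TropicalData n p)

/-- Near `x`, the intersection current is computed by the polynomials whose exponents are the ones
active at `x`. -/
theorem exists_tendsto_softMax_active (hp : p ≤ n) {T : Current n p}
    (hT : IsIntersectionCurrent P.toFun T) (x : V n) :
    ∃ R > 0, ∀ α : TestForm n (n - p), tsupport α ⊆ Metric.closedBall x R →
      Tendsto (fun k => smoothPairing (fun i => softMax (P.coeff i) (P.active x i) k) α) atTop
        (𝓝 (T α)) := by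
  obtain ⟨R, hR, hx⟩ := Metric.eventually_nhds_iff_ball.1 (P.eventually_active_subset x)
  refine ⟨R / 2, half_pos hR, fun α hα => ?_⟩
  have hG := P.isApproximation_softMax
  obtain ⟨M, -, hM⟩ := exists_abs_le_on_ball P.continuous_toFun x R
  have h := tendsto_smoothPairing_sub hp
    (g := fun k i => softMax (P.coeff i) (P.active x i) k)
    (fun k i => contDiff_softMax _ (P.active_nonempty x i) k)
    (fun k i => convexOn_softMax _ (P.active_nonempty x i) k) hG.contDiff hG.convexOn
    (f := P.toFun) (half_pos hR) (half_lt_self hR)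
    (fun i => (tendstoUniformly_softMax (P.coeff i)
      (P.active_nonempty x i)).tendstoUniformlyOn.congr_right fun y hy =>
        (P.toFun_eq_sup'_of_active_subset (hx y hy i)).symm)
    (fun i => hG.tendstoUniformlyOn_ball i x R) hM hα
  simpa using h.add (hT _ hG.contDiff hG.convexOn hG.tendsto α)

/-- The support does not meet the cells of dimension larger than `n - p`. -/
theorem notMem_dsupport_of_finrank_gt (hp : p ≤ n) {T : Current n p}
    (hT : IsIntersectionCurrent P.toFun T) {x : V n}
    (hx : n < Module.finrank ℝ (lineality (P.active x)) + p) : x ∉ Distribution.dsupport T := by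
  obtain ⟨R, hR, h⟩ := P.exists_tendsto_softMax_active hp hT x
  rw [Distribution.notMem_dsupport_iff]
  refine ⟨Metric.ball x R, fun α hα => ?_, Metric.isOpen_ball, Metric.mem_ball_self hR⟩
  refine tendsto_nhds_unique (h α (hα.trans Metric.ball_subset_closedBall)) ?_
  refine tendsto_const_nhds.congr fun k => ?_
  exact (smoothPairing_eq_zero_of_invariant hp
    (fun i => contDiff_softMax _ (P.active_nonempty x i) k) hx
    (fun i w hw => exists_softMax_add (P.active_nonempty x) hw i _ k) α).symm

/-- Each cell is either contained in the support or disjoint from it. -/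
theorem mem_dsupport_of_active_eq (hp : p ≤ n) {T : Current n p}
    (hT : IsIntersectionCurrent P.toFun T) {x y : V n} (hxy : P.active y = P.active x)
    (hy : y ∈ Distribution.dsupport T) : x ∈ Distribution.dsupport T := by
  by_contra hx
  refine absurd hy ?_
  obtain ⟨s, hs, hso, hxs⟩ := (Distribution.notMem_dsupport_iff x).1 hx
  obtain ⟨r, hr, hrs⟩ := Metric.isOpen_iff.1 hso x hxs
  obtain ⟨R, hR, h⟩ := P.exists_tendsto_softMax_active hp hT x
  obtain ⟨R', hR', h'⟩ := P.exists_tendsto_softMax_active hp hT y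
  have hw : y - x ∈ lineality (P.active x) := by
    rw [← hxy]
    exact P.sub_mem_lineality fun i => by rw [hxy]
  rw [Distribution.notMem_dsupport_iff]
  set δ := min (r / 2) (min R R')
  have hδ : 0 < δ := by positivity
  refine ⟨Metric.ball y δ, fun α hα => ?_, Metric.isOpen_ball, Metric.mem_ball_self hδ⟩
  have hα' : tsupport α ⊆ Metric.closedBall y δ := hα.trans Metric.ball_subset_closedBall
  have htr : tsupport (α.translate (y - x)) ⊆ Metric.closedBall x δ :=
    TestForm.tsupport_translate_subset (by rwa [add_sub_cancel])
  have h0 : T (α.translate (y - x)) = 0 := hs _ (htr.trans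
    ((Metric.closedBall_subset_ball ((min_le_left _ _).trans_lt (half_lt_self hr))).trans hrs))
  have h1 := h _ (htr.trans (Metric.closedBall_subset_closedBall
    ((min_le_right _ _).trans (min_le_left _ _))))
  have h2 := h' α (hα'.trans (Metric.closedBall_subset_closedBall
    ((min_le_right _ _).trans (min_le_right _ _))))
  rw [h0] at h1
  refine tendsto_nhds_unique h2 (h1.congr fun k => ?_)
  rw [hxy]
  exact smoothPairing_translate (fun i => exists_softMax_add (P.active_nonempty x) hw i _ k) α

/-- Near `x`, the polynomials differ from an affine function by at most a multiple of the distance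
to the cell of `x`. -/
theorem exists_abs_sup'_sub_le (x : V n) (b : Fin p → Fin n → ℤ) (hb : ∀ i, b i ∈ P.active x i) :
    ∃ M, 0 ≤ M ∧ ∀ i z, |((P.active x i).sup' (P.active_nonempty x i)
        fun a => monomialFun (P.coeff i) a z) - monomialFun (P.coeff i) (b i) z| ≤
      M * ‖(z - x) - (lineality (P.active x)).starProjection (z - x)‖ := by
  refine ⟨∑ i, ∑ a ∈ P.active x i, ‖linForm a - linForm (b i)‖, by positivity, fun i z => ?_⟩
  obtain ⟨a, ha, hmax⟩ := Finset.exists_mem_eq_sup' (P.active_nonempty x i)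
    fun a => monomialFun (P.coeff i) a z
  rw [hmax]
  set W := lineality (P.active x)
  set v := z - x with hv
  have hz : z = x + v := by rw [hv]; abel
  have h1 : monomialFun (P.coeff i) a z - monomialFun (P.coeff i) (b i) z =
      (linForm a - linForm (b i)) (v - W.starProjection v) := by
    have h2 := (P.mem_active.1 ha).2.trans (P.mem_active.1 (hb i)).2.symm
    have h3 := Submodule.starProjection_apply_mem W v i a ha (b i) (hb i)
    rw [hz, monomialFun_add, monomialFun_add, h2]
    simp only [map_sub, sub_apply, h3]
    ring
  rw [h1]
  rw [← Real.norm_eq_abs]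
  refine ((linForm a - linForm (b i)).le_opNorm (v - W.starProjection v)).trans ?_
  gcongr
  exact (Finset.single_le_sum (f := fun a => ‖linForm a - linForm (b i)‖)
    (fun _ _ => norm_nonneg _) ha).trans (Finset.single_le_sum
      (f := fun i => ∑ a ∈ P.active x i, ‖linForm a - linForm (b i)‖)
      (fun _ _ => by positivity) (Finset.mem_univ i))

/-- The mass of the intersection current in the tube of radius `R / t` around a cell of codimension
larger than `p` is at most a multiple of `1 / t`: the Hessians of the cutoff functions of the tube
are of size `t²`, the polynomials are `O(1/t)` up to affine functions, and the volume of the tube is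
`O(t^{-(p+1)})`. -/
theorem exists_abs_apply_smulFun_le (hp : p ≤ n) {T : Current n p} {x : V n}
    (hx : Module.finrank ℝ (lineality (P.active x)) + p < n) {χ : ℕ → V n → ℝ} {c R : ℝ}
    (hR : 0 < R) (hχ : IsCutoffFamily p χ c (Metric.ball 0 R))
    {R' : ℝ} (hlim : ∀ α : TestForm n (n - p), tsupport α ⊆ Metric.closedBall x R' →
      Tendsto (fun k => smoothPairing (fun i => softMax (P.coeff i) (P.active x i) k) α) atTop
        (𝓝 (T α))) {α : TestForm n (n - p)} (hα : tsupport α ⊆ Metric.closedBall x R') :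
    ∃ D, ∀ t : ℝ, 1 ≤ t →
      ∀ hψ : ContDiff ℝ ∞ fun z => χ p (stretch (lineality (P.active x)) t (z - x)),
      |T (TestForm.smulFun _ hψ α)| ≤ D / t := by
  choose b hb using P.active_nonempty x
  obtain ⟨M, hM, hMb⟩ := P.exists_abs_sup'_sub_le x b hb
  obtain ⟨C, hC, hCb⟩ := exists_abs_smoothPairing_le n hp
  obtain ⟨a, ha⟩ := (TestFunction.contDiff α).continuous.bounded_above_of_compact_support
    (TestFunction.hasCompactSupport α)
  have ha0 : 0 ≤ a := (norm_nonneg _).trans (ha 0)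
  set W := lineality (P.active x)
  set m := Module.finrank ℝ Wᗮ
  have hm : p + 1 ≤ m := by
    have := Submodule.finrank_add_finrank_orthogonal W
    rw [finrank_euclideanSpace_fin] at this
    omega
  have hI : 0 ≤ ∫ z, χ 0 z := integral_nonneg (hχ.nonneg 0)
  set E := C * (a * ((c * (2 * n) ^ 2 * (M * R + 1)) ^ p * ∫ z, χ 0 z))
  have hE : 0 ≤ E := by
    have := hχ.const_nonneg
    positivity
  refine ⟨E, fun t ht hψ => ?_⟩
  have ht0 : 0 < t := by linarith
  have hχt := hχ.comp_stretch W ht x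
  set β := TestForm.smulFun _ hψ α
  refine le_of_tendsto (hlim β ((TestForm.tsupport_smulFun_subset _ hψ α).2.trans hα)).abs ?_
  have hev : ∀ᶠ k in atTop, ∀ i, ∀ z, |((P.active x i).sup' (P.active_nonempty x i)
      fun a => monomialFun (P.coeff i) a z) - softMax (P.coeff i) (P.active x i) k z| < 1 / t := by
    rw [eventually_all]
    intro i
    exact Metric.tendstoUniformly_iff.1 (tendstoUniformly_softMax (P.coeff i)
      (P.active_nonempty x i)) (1 / t) (by positivity)
  filter_upwards [hev] with k hk
  set g : Fin p → V n → ℝ := fun i z =>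
    softMax (P.coeff i) (P.active x i) k z - monomialFun (P.coeff i) (b i) z
  have hs := fun i => contDiff_softMax (P.coeff i) (P.active_nonempty x i) k
  have hg : ∀ i, ContDiff ℝ ∞ (g i) := fun i => (hs i).sub (contDiff_monomialFun _ _)
  have hgc : ∀ i, ConvexOn ℝ univ (g i) := fun i =>
    convexOn_sub_monomialFun (convexOn_softMax _ (P.active_nonempty x i) k) _ _
  have hgM : ∀ i, ∀ z ∈ {z | stretch W t (z - x) ∈ Metric.ball 0 R},
      |g i z| ≤ (M * R + 1) / t := by
    intro i z hz
    have h1 := hMb i z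
    have h2 := (hk i z).le
    have h3 : ‖(z - x) - W.starProjection (z - x)‖ ≤ R / t := by
      rw [le_div_iff₀' ht0]
      refine (mul_norm_sub_starProjection_le W ht0.le (z - x)).trans ?_
      have := mem_ball_zero_iff.1 hz
      exact this.le
    have h4 : M * ‖(z - x) - W.starProjection (z - x)‖ ≤ M * (R / t) := by gcongr
    have h5 : (M * R + 1) / t = M * (R / t) + 1 / t := by ring
    rw [abs_le] at h1 h2 ⊢
    simp only [g]
    constructor <;> linarith [h1.1, h1.2, h2.1, h2.2]
  rw [smoothPairing_congr_hess hp hs hg (fun i z => by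
    rw [hess_sub (hs i) (contDiff_monomialFun _ _), hess_monomialFun, sub_zero])]
  refine (hCb hχt le_rfl g hg hgc _ (by positivity) hgM β a ha0 fun z => ?_).trans ?_
  · rw [TestForm.smulFun_apply, norm_smul, Real.norm_of_nonneg (hχ.nonneg _ _), mul_comm]
    exact mul_le_mul_of_nonneg_right (ha z) (hχ.nonneg _ _)
  · rw [integral_comp_stretch W ht0 (hχ.contDiff 0).continuous]
    have h6 : c * (2 * n * t) ^ 2 * ((M * R + 1) / t) = (c * (2 * n) ^ 2 * (M * R + 1)) * t := by
      field_simp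
    have h7 : t ^ p * (t ^ m)⁻¹ ≤ 1 / t := by
      rw [← div_eq_mul_inv, div_le_div_iff₀ (by positivity) ht0, one_mul, ← pow_succ]
      exact pow_le_pow_right₀ ht hm
    rw [h6, mul_pow]
    calc C * (a * ((c * (2 * n) ^ 2 * (M * R + 1)) ^ p * t ^ p * ((t ^ m)⁻¹ * ∫ z, χ 0 z)))
        = E * (t ^ p * (t ^ m)⁻¹) := by simp only [E]; ring
      _ ≤ E * (1 / t) := by gcongr
      _ = E / t := by ring

/-- The intersection current does not charge a cell of dimension less than `n - p`: such a cell cannot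
be all of the support near a point `x`. -/
theorem notMem_dsupport_of_eventually (hp : p ≤ n) {T : Current n p}
    (hT : IsIntersectionCurrent P.toFun T) {x : V n}
    (hx : Module.finrank ℝ (lineality (P.active x)) + p < n)
    (hS : ∀ᶠ y in 𝓝 x, y ∈ Distribution.dsupport T → y - x ∈ lineality (P.active x)) :
    x ∉ Distribution.dsupport T := by
  obtain ⟨R, hR, hlim⟩ := P.exists_tendsto_softMax_active hp hT x
  obtain ⟨R', hR', hS'⟩ := Metric.eventually_nhds_iff_ball.1 hS
  set δ := min R R' / 2
  have hmin : 0 < min R R' := by positivity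
  have hδ : 0 < δ := half_pos hmin
  have hδR : δ < R := (half_lt_self hmin).trans_le (min_le_left _ _)
  have hδR' : δ < R' := (half_lt_self hmin).trans_le (min_le_right _ _)
  obtain ⟨χ, c, hχ, hχ1⟩ := exists_isCutoffFamily p (0 : V n) hδ hδR
  rw [Distribution.notMem_dsupport_iff]
  refine ⟨Metric.ball x δ, fun α hα => ?_, Metric.isOpen_ball, Metric.mem_ball_self hδ⟩
  obtain ⟨D, hD⟩ := P.exists_abs_apply_smulFun_le hp hx hR hχ hlim
    (hα.trans (Metric.ball_subset_closedBall.trans (Metric.closedBall_subset_closedBall hδR.le)))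
  refine eq_zero_of_forall_abs_le_div (D := D) fun t ht => ?_
  set W := lineality (P.active x)
  have hψ : ContDiff ℝ ∞ fun z => χ p (stretch W t (z - x)) := (hχ.comp_stretch W ht x).contDiff p
  have hψ' : ContDiff ℝ ∞ fun z => 1 - χ p (stretch W t (z - x)) := contDiff_const.sub hψ
  have hsplit : α = TestForm.smulFun _ hψ α + TestForm.smulFun _ hψ' α := by
    ext1 z
    have : (TestForm.smulFun _ hψ α + TestForm.smulFun _ hψ' α) z =
        χ p (stretch W t (z - x)) • α z + (1 - χ p (stretch W t (z - x))) • α z := rfl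
    rw [this, ← add_smul, add_sub_cancel, one_smul]
  -- Away from the tube around the cell, the test form does not meet the support of the current.
  have h0 : T (TestForm.smulFun _ hψ' α) = 0 := by
    refine eq_zero_of_disjoint_dsupport T fun z hz hzT => ?_
    have hzα := hα ((TestForm.tsupport_smulFun_subset _ hψ' α).2 hz)
    have hzW := hS' z (Metric.ball_subset_ball hδR'.le hzα) hzT
    have h1 : stretch W t (z - x) ∈ Metric.ball 0 δ := by
      rw [stretch_of_mem hzW, mem_ball_zero_iff, ← dist_eq_norm]
      exact hzα
    have h2 : ∀ᶠ y in 𝓝 z, stretch W t (y - x) ∈ Metric.ball (0 : V n) δ :=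
      (by fun_prop : Continuous fun y => stretch W t (y - x)).continuousAt.eventually_mem
        (Metric.isOpen_ball.mem_nhds h1)
    refine notMem_tsupport_iff_eventuallyEq.2 ?_ ((TestForm.tsupport_smulFun_subset _ hψ' α).1 hz)
    filter_upwards [h2] with y hy
    change (1 - χ p (stretch W t (y - x))) = 0
    rw [hχ1 p _ (Metric.ball_subset_closedBall hy), sub_self]
  rw [hsplit, map_add, h0, add_zero]
  exact hD t ht hψ

/-- The support is the closure of its part in the cells of dimension `n - p`. This is proved by
induction on the codimension of the cell of `x`. -/
theorem mem_closure_of_mem_dsupport (hp : p ≤ n) {T : Current n p}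
    (hT : IsIntersectionCurrent P.toFun T) {x : V n} (hx : x ∈ Distribution.dsupport T) :
    x ∈ closure {y ∈ Distribution.dsupport T |
      Module.finrank ℝ (lineality (P.active y)) = n - p} := by
  induction hd : n - Module.finrank ℝ (lineality (P.active x)) using Nat.strong_induction_on
    generalizing x with
  | _ d ih =>
    have hle : ∀ y : V n, Module.finrank ℝ (lineality (P.active y)) ≤ n := fun y =>
      (Submodule.finrank_le _).trans (finrank_euclideanSpace_fin).le
    have hxn : Module.finrank ℝ (lineality (P.active x)) + p ≤ n := by
      by_contra h
      exact P.notMem_dsupport_of_finrank_gt hp hT (not_le.1 h) hx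
    rcases hxn.eq_or_lt with heq | hlt
    · exact subset_closure ⟨hx, by omega⟩
    · by_contra hcl
      refine P.notMem_dsupport_of_eventually hp hT hlt ?_ hx
      filter_upwards [P.eventually_active_subset x, isClosed_closure.isOpen_compl.mem_nhds hcl]
        with y hy hycl hyT
      -- The other cells near `x` have larger dimension, so that their points in the support are in
      -- the closure by induction.
      by_cases hne : P.active y = P.active x
      · rw [← hne]
        exact P.sub_mem_lineality hy
      · have hfin := P.finrank_lineality_lt hy hne
        have := hle y
        exact absurd (ih _ (by omega) hyT rfl) hycl

end TropicalData

/-! ### Polyhedral pieces -/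

/-- Relatively open polyhedra are smooth submanifolds: near a point `x` of the polyhedron, the
translation by `-x` is a straightening chart. -/
theorem IsAffinePiece.isSmoothPiece {A : Set (V n)} {d : ℕ} (hA : IsAffinePiece A d) :
    IsSmoothPiece A d := by
  obtain ⟨hne, L, hL, H, hH, rfl⟩ := hA
  refine ⟨hne, fun x hx => ?_⟩
  have hopen : IsOpen {y : V n | ∀ h ∈ H, h.2 < h.1 y} := by
    simp only [ofPred_forall]
    exact hH.isOpen_biInter fun h _ => isOpen_lt continuous_const h.1.continuous
  refine ⟨(Homeomorph.addRight (-x)).toOpenPartialHomeomorph.restrOpen _ hopen, ?_, ?_, ?_,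
    L.direction, hL, fun y hy => ?_⟩
  · exact ⟨mem_univ _, hx.2⟩
  · exact (contDiff_id.add contDiff_const).contDiffOn
  · exact (contDiff_id.add contDiff_const).contDiffOn
  · change y ∈ L ∧ (∀ h ∈ H, h.2 < h.1 y) ↔ y + -x ∈ L.direction
    rw [← sub_eq_add_neg, ← vsub_eq_sub, AffineSubspace.vsub_right_mem_direction_iff_mem hx.1]
    exact and_iff_left hy.2

theorem IsPiecewiseAffine.hasDimension {S : Set (V n)} {d : ℕ} (hS : IsPiecewiseAffine S d) :
    HasDimension S d := by
  obtain ⟨M, N, hM, hN, hne, hMp, hNp, hrest⟩ := hS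
  refine ⟨M, N, hM, hN, hne, fun A hA => (hMp A hA).isSmoothPiece, fun B hB => ?_, hrest⟩
  obtain ⟨e, he, hBe⟩ := hNp B hB
  exact ⟨e, he, hBe.isSmoothPiece⟩

namespace TropicalData

variable (P : TropicalData n p)

/-- The cell of `x`: the set of points at which the same monomials attain the maxima as at `x`. -/
def cell (x : V n) : Set (V n) :=
  {y | P.active y = P.active x}

/-- The cell of `x` is cut out of the affine space through `x` in the direction of the lineality space
by the inequalities between the active and the other monomials. -/
theorem isAffinePiece_cell (x : V n) :
    IsAffinePiece (P.cell x) (Module.finrank ℝ (lineality (P.active x))) := by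
  refine ⟨⟨x, rfl⟩, AffineSubspace.mk' x (lineality (P.active x)), by
    rw [AffineSubspace.direction_mk'], ⋃ i, ⋃ b ∈ P.active x i, ⋃ a ∈ P.supp i \ P.active x i,
      {(linForm b - linForm a, P.coeff i b - P.coeff i a)}, ?_, ?_⟩
  · exact finite_iUnion fun i => (Finset.finite_toSet _).biUnion fun b _ =>
      (Finset.finite_toSet _).biUnion fun a _ => finite_singleton _
  · ext y
    have hmem : y ∈ AffineSubspace.mk' x (lineality (P.active x)) ↔
        y - x ∈ lineality (P.active x) := by
      rw [AffineSubspace.mem_mk', vsub_eq_sub]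
    have hlt : ∀ i a b, (P.coeff i b - P.coeff i a < (linForm b - linForm a) y) ↔
        monomialFun (P.coeff i) a y < monomialFun (P.coeff i) b y := by
      intro i a b
      simp only [monomialFun, sub_apply]
      constructor <;> intro h <;> linarith
    simp only [mem_ofPred_eq, hmem, mem_iUnion, exists_prop, mem_singleton_iff, Finset.mem_sdiff]
    constructor
    · intro (hy : P.active y = P.active x)
      refine ⟨hy ▸ P.sub_mem_lineality fun i => (congrFun hy i).subset, ?_⟩
      rintro _ ⟨i, b, hb, a, ⟨ha, hax⟩, rfl⟩
      rw [hlt]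
      rw [← hy] at hb hax
      rw [(P.mem_active.1 hb).2]
      exact lt_of_le_of_ne (P.monomialFun_le ha y) fun h => hax (P.mem_active.2 ⟨ha, h⟩)
    · rintro ⟨hy, hyH⟩
      refine P.active_eq_of_sub_mem_lineality (fun i a ha => ?_) hy
      by_contra hax
      obtain ⟨b, hb⟩ := P.active_nonempty x i
      have h := hyH _ ⟨i, b, hb, a, ⟨(P.mem_active.1 ha).1, hax⟩, rfl⟩
      rw [hlt, (P.mem_active.1 ha).2] at h
      exact h.not_ge (P.monomialFun_le (P.mem_active.1 hb).1 y)

theorem finite_range_cell : (range P.cell).Finite := by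
  have h : (range P.active).Finite :=
    (Finset.finite_toSet (Fintype.piFinset fun i => (P.supp i).powerset)).subset (by
      rintro _ ⟨x, rfl⟩
      simp only [Finset.mem_coe, Fintype.mem_piFinset, Finset.mem_powerset]
      exact fun i a ha => (P.mem_active.1 ha).1)
  refine (h.image fun B => {y | P.active y = B}).subset ?_
  rintro _ ⟨x, rfl⟩
  exact ⟨_, ⟨x, rfl⟩, rfl⟩

/-- The pieces of the support are the cells that it contains. -/
theorem isPiecewiseAffine_dsupport (hp : p ≤ n) {T : Current n p}
    (hT : IsIntersectionCurrent P.toFun T) (hT0 : T ≠ 0) :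
    IsPiecewiseAffine (Distribution.dsupport T) (n - p) := by
  set S := Distribution.dsupport T with hS
  set d : V n → ℕ := fun x => Module.finrank ℝ (lineality (P.active x)) with hd
  have hcell : ∀ x ∈ S, P.cell x ⊆ S := fun x hx y hy =>
    P.mem_dsupport_of_active_eq hp hT (Eq.symm hy) hx
  have hle : ∀ x ∈ S, d x ≤ n - p := by
    intro x hx
    by_contra h
    exact P.notMem_dsupport_of_finrank_gt hp hT (by simp only [hd] at h; omega) hx
  have hmax : {y ∈ S | d y = n - p} = ⋃₀ (P.cell '' {x ∈ S | d x = n - p}) := by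
    ext y
    simp only [sUnion_image, mem_iUnion, mem_ofPred_eq, exists_prop]
    constructor
    · exact fun hy => ⟨y, hy, rfl⟩
    · rintro ⟨x, ⟨hx, hdx⟩, hy⟩
      refine ⟨hcell x hx hy, ?_⟩
      rw [← hdx]
      exact congrArg (fun B => Module.finrank ℝ (lineality B)) hy
  have hclos : S = closure (⋃₀ (P.cell '' {x ∈ S | d x = n - p})) := by
    rw [← hmax]
    exact subset_antisymm (fun x hx => P.mem_closure_of_mem_dsupport hp hT hx)
      (closure_minimal (fun y hy => hy.1) (Distribution.isClosed_dsupport))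
  refine ⟨P.cell '' {x ∈ S | d x = n - p}, P.cell '' {x ∈ S | d x < n - p},
    P.finite_range_cell.subset (image_subset_range _ _),
    P.finite_range_cell.subset (image_subset_range _ _), ?_, ?_, ?_, ?_, ?_, hclos⟩
  -- A current with empty support vanishes.
  · by_contra h
    rw [not_nonempty_iff_eq_empty] at h
    rw [h, sUnion_empty, closure_empty] at hclos
    refine hT0 (ContinuousLinearMap.ext fun α => eq_zero_of_disjoint_dsupport T ?_)
    intro z _ hz
    rw [← hS, hclos] at hz
    exact hz
  · rintro _ ⟨x, ⟨-, hx⟩, rfl⟩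
    exact hx ▸ P.isAffinePiece_cell x
  · rintro _ ⟨x, ⟨-, hx⟩, rfl⟩
    exact ⟨_, hx, P.isAffinePiece_cell x⟩
  · rw [← image_union]
    rintro _ ⟨x, -, rfl⟩ _ ⟨y, -, rfl⟩ hxy
    refine Set.disjoint_left.2 fun z (hzx : P.active z = P.active x)
      (hzy : P.active z = P.active y) => hxy ?_
    simp only [cell, ← hzx, ← hzy]
  · rw [← sUnion_union, ← image_union, sUnion_image]
    refine subset_antisymm (fun x hx => ?_) (iUnion₂_subset fun x hx => ?_)
    · exact mem_biUnion ((hle x hx).eq_or_lt.imp (fun h => ⟨hx, h⟩) fun h => ⟨hx, h⟩)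
        (rfl : P.active x = P.active x)
    · exact hcell x (hx.elim And.left And.left)

end TropicalData

theorem exists_tropicalData {f : Fin p → V n → ℝ} (hf : ∀ i, IsTropicalPolynomial (f i)) :
    ∃ P : TropicalData n p, P.toFun = f := by
  choose A hA ν hν using hf
  refine ⟨⟨A, hA, ν⟩, ?_⟩
  ext i x
  rw [hν]
  simp only [TropicalData.toFun, monomialFun_eq]

end SuperCurrents

theorem mainTheorem12 {n p : ℕ} (hp : p ≤ n)
    (f : Fin p → SuperCurrents.V n → ℝ)
    (hf : ∀ i, SuperCurrents.IsTropicalPolynomial (f i)) :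
    (∃! T : SuperCurrents.Current n p, SuperCurrents.IsIntersectionCurrent f T) ∧
    ∀ T : SuperCurrents.Current n p, SuperCurrents.IsIntersectionCurrent f T → T ≠ 0 →
      SuperCurrents.HasDimension (Distribution.dsupport T) (n - p) ∧
      SuperCurrents.IsPiecewiseAffine (Distribution.dsupport T) (n - p) := by
  obtain ⟨P, rfl⟩ := SuperCurrents.exists_tropicalData hf
  refine ⟨P.isApproximation_softMax.existsUnique hp, fun T hT hT0 => ?_⟩
  have h := P.isPiecewiseAffine_dsupport hp hT hT0
  exact ⟨h.hasDimension, h⟩
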